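/- Fix a real number $\alpha>0$. On the doubly slit plane $\mathcal H=\mathbb C\setminus\big((-\infty,-\tfrac\pi2)\cup(\tfrac\pi2,\infty)\big)$ let powers of $\cos$ be taken with the branch equal to $1$ at $0$, and put $$\tilde F(x)=\int_{-\pi/2}^{x}(\cos y)^{\alpha-1}\,dy ,\qquad x\in\mathcal H ,$$ the integral being along any contour in $\mathcal H$. For $\nu,\kappa\in\mathbb C$ with $\nu-\kappa\in\mathbb N_0=\{0,1,2,\dots\}$ let $$\tilde B\{\nu,\kappa\}=\frac{\alpha^{\nu-\kappa}}{\Gamma(\kappa)(\nu-\kappa)!}\int_{-\pi/2}^{\pi/2}(\cos x)^{\alpha\kappa-1}(\tilde F(x))^{\nu-\kappa}\,dx\qquad(\operatorname{Re}\kappa>0),$$ $$\tilde A[\nu,\kappa]=\frac{\alpha^{\nu-\kappa+1}}{(\nu-\kappa)!}\cdot\frac{\Gamma(\nu+1)}{2\pi i}\int_{-i\infty}^{+i\infty}(\cos x)^{-\alpha\nu-1}(\tilde F(x))^{\nu-\kappa}\,dx\qquad(\operatorname{Re}\kappa>-\tfrac1\alpha,\ -(\nu+1)\notin\mathbb N_0).$$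 These integrals converge absolutely (the second one for all $\kappa$ with $\operatorname{Re}\kappa>-\frac1\alpha$), and for each fixed value of $\nu-\kappa\in\mathbb N_0$ the functions $\tilde B\{\nu,\kappa\}$ and $\tilde A[\nu,\kappa]$ extend (uniquely) to meromorphic functions of $\kappa\in\mathbb C$, denoted by the same symbols. Let $n,d,k\in\mathbb C$ be such that $n-d\in\mathbb N_0$ and $d-k\in\mathbb N_0$ are arbitrary but fixed. Then the following equalities of meromorphic functions of the complex variable $k$ (equivalently, of $n$) hold: $$\sum_{\substack{s\in\{0,2,4,\dots\},\ s\le d-k\\ m:=d-s}}\tilde B\{n,m\}\,\frac{\left(m-\frac1\alpha\right)\Gamma(m)}{\Gamma\left(m+1-\frac2\alpha\right)}\,\tilde A\left[m-\tfrac2\alpha,k-\tfrac2\alpha\right]=\sum_{\substack{q\in\{0,2,4,\dots\}\\ q\le d-k}}\tilde B\left\{n+\tfrac q\alpha,d-q+\tfrac q\alpha\right\}\tilde A\left[d-q+\tfrac q\alpha,k+\tfrac q\alpha\right],$$ $$\sum_{\substack{s\in\{2,4,6,\dots\},\ s\le n-d\\ m:=d+s}}\tilde B\{n,m\}\,\frac{\left(m-\frac1\alpha\right)\Gamma(m)}{\Gamma\left(m+1-\frac2\alpha\right)}\,\tilde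 A\left[m-\tfrac2\alpha,k-\tfrac2\alpha\right]=\sum_{\substack{q\in\{2,4,6,\dots\}\\ q\le n-d}}\tilde B\left\{n-\tfrac q\alpha,d+q-\tfrac q\alpha\right\}\tilde A\left[d+q-\tfrac q\alpha,k-\tfrac q\alpha\right].$$ -/

import Mathlib

noncomputable section

namespace BetaPrime

/-- The branch of `log (cos x)` on the doubly slit plane
`ℂ \ ((-∞, -π/2) ∪ (π/2, ∞))` (where it is finite, that is for `x ≠ ± π/2`) that vanishes at `x = 0`:
the integral of its derivative `-tan` along the segment from `0` to `x`. -/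
def logCos (x : ℂ) : ℂ :=
  -(x * ∫ t in (0 : ℝ)..1, Complex.tan ((t : ℂ) * x))

/-- The branch of `(cos x) ^ s` on the doubly slit plane that equals `1` at `x = 0`. -/
def cosPow (s x : ℂ) : ℂ :=
  Complex.exp (s * logCos x)

/-- On the strip `|Re x| < π/2`, which contains the real interval and the imaginary axis on which
the functions are integrated below, the branch is the principal one. -/
theorem logCos_eq_log_cos (x : ℂ) (hx : |x.re| < Real.pi / 2) :
    logCos x = Complex.log (Complex.cos x) := by
  have hre : ∀ t ∈ Set.uIcc (0 : ℝ) 1, 0 < (Complex.cos ((t : ℂ) * x)).re := by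
    intro t ht
    rw [Set.uIcc_of_le zero_le_one] at ht
    have h1 : |t * x.re| < Real.pi / 2 := by
      rw [abs_mul, abs_of_nonneg ht.1]
      exact lt_of_le_of_lt (mul_le_of_le_one_left (abs_nonneg _) ht.2) hx
    rw [abs_lt] at h1
    rw [Complex.cos_eq]
    have h2 := Real.cos_pos_of_mem_Ioo (x := t * x.re) ⟨by linarith [h1.1], h1.2⟩
    have h3 := Real.cosh_pos (t * x.im)
    have e1 : ((t : ℂ) * x).re = t * x.re := by simp
    have e2 : ((t : ℂ) * x).im = t * x.im := by simp
    rw [e1, e2]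
    rw [← Complex.ofReal_cos, ← Complex.ofReal_cosh, ← Complex.ofReal_sin, ← Complex.ofReal_sinh]
    simp only [Complex.sub_re, Complex.mul_re, Complex.ofReal_re, Complex.ofReal_im,
      Complex.mul_im, Complex.I_re, Complex.I_im]
    nlinarith [mul_pos h2 h3]
  have hne : ∀ t ∈ Set.uIcc (0 : ℝ) 1, Complex.cos ((t : ℂ) * x) ≠ 0 := by
    intro t ht h0
    have := hre t ht
    rw [h0] at this
    simp at this
  have hd : ∀ t ∈ Set.uIcc (0 : ℝ) 1,
      HasDerivAt (fun t : ℝ => Complex.log (Complex.cos ((t : ℂ) * x)))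
        (-(x * Complex.tan ((t : ℂ) * x))) t := by
    intro t ht
    have h1 : HasDerivAt (fun t : ℝ => (t : ℂ) * x) x t := by
      simpa using (Complex.ofRealCLM.hasDerivAt (x := t)).mul_const x
    have h0 : HasDerivAt (fun t : ℝ => Complex.cos ((t : ℂ) * x))
        (-Complex.sin ((t : ℂ) * x) * x) t :=
      HasDerivAt.comp (h₂ := Complex.cos) t (Complex.hasDerivAt_cos ((t : ℂ) * x)) h1
    have h2 := h0.clog_real (Or.inl (hre t ht))
    convert h2 using 1
    rw [Complex.tan_eq_sin_div_cos]
    ring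
  have hc : ContinuousOn (fun t : ℝ => -(x * Complex.tan ((t : ℂ) * x))) (Set.uIcc (0 : ℝ) 1) := by
    intro t ht
    refine ContinuousAt.continuousWithinAt ?_
    refine (continuousAt_const.mul ?_).neg
    exact ContinuousAt.comp (f := fun t : ℝ => (t : ℂ) * x)
      (Complex.continuousAt_tan.2 (hne t ht)) (by fun_prop)
  have key := intervalIntegral.integral_eq_sub_of_hasDerivAt hd hc.intervalIntegrable
  rw [intervalIntegral.integral_neg, intervalIntegral.integral_const_mul] at key
  rw [logCos, key]
  simp

/-- `Ftilde α x = ∫_{-π/2}^x (cos y) ^ (α - 1) dy` on the doubly slit plane.  The contour is the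
polygon `-π/2 → 0 → i Im x → x`, which stays in the doubly slit plane for every `x` of that
plane; the integral does not depend on the choice of the contour. -/
def Ftilde (α : ℝ) (x : ℂ) : ℂ :=
  (∫ t in (-(Real.pi / 2))..(0 : ℝ), cosPow ((α : ℂ) - 1) (t : ℂ))
    + Complex.I * (∫ t in (0 : ℝ)..x.im, cosPow ((α : ℂ) - 1) (Complex.I * (t : ℂ)))
    + ∫ t in (0 : ℝ)..x.re, cosPow ((α : ℂ) - 1) ((t : ℂ) + Complex.I * (x.im : ℂ))

/-- The integrand `(cos x) ^ (α κ - 1) (F x) ^ N` of the `B`-quantities, `N = ν - κ`. -/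
def integrandB (α : ℝ) (N : ℕ) (κ : ℂ) (x : ℝ) : ℂ :=
  cosPow ((α : ℂ) * κ - 1) (x : ℂ) * Ftilde α (x : ℂ) ^ N

/-- The integral formula for `B{ν, κ}`, `ν = κ + N`. -/
def integralB (α : ℝ) (N : ℕ) (κ : ℂ) : ℂ :=
  (α : ℂ) ^ N / (Complex.Gamma κ * (N.factorial : ℂ))
    * ∫ x in (-(Real.pi / 2))..(Real.pi / 2), integrandB α N κ x

/-- The integrand `(cos x) ^ (-α ν - 1) (F x) ^ N` of the `A`-quantities at the point `x = i y` of
the imaginary axis, `ν = κ + N`. -/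
def integrandA (α : ℝ) (N : ℕ) (κ : ℂ) (y : ℝ) : ℂ :=
  cosPow (-(α : ℂ) * (κ + N) - 1) (Complex.I * (y : ℂ)) * Ftilde α (Complex.I * (y : ℂ)) ^ N

/-- The integral formula for `A[ν, κ]`, `ν = κ + N`; along the imaginary axis `dx = i dy`. -/
def integralA (α : ℝ) (N : ℕ) (κ : ℂ) : ℂ :=
  (α : ℂ) ^ (N + 1) / (N.factorial : ℂ)
    * (Complex.Gamma (κ + N + 1) / (2 * (Real.pi : ℂ) * Complex.I))
    * (Complex.I * ∫ y : ℝ, integrandA α N κ y)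

/-- The half-plane on which the integral formula for `B{κ + N, κ}` is used. -/
def domainB : Set ℂ := {κ | 0 < κ.re}

/-- The half-plane `Re κ > -1/α`, on which the integral for `A[κ + N, κ]` converges absolutely,
without the poles of the factor `Γ(ν + 1) = Γ(κ + N + 1)`. -/
def domainA (α : ℝ) (N : ℕ) : Set ℂ :=
  {κ | -(1 / α) < κ.re ∧ ∀ j : ℕ, κ + N + 1 ≠ -(j : ℂ)}

/-- `g` is a meromorphic function on `ℂ` (in normal form: its value at a removable singularity is
the limit, its value at a pole is `0`) that extends the restriction of `f` to `U`.  If `U` is open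
and nonempty, there is at most one such `g`. -/
def IsMeromorphicExtension (U : Set ℂ) (f g : ℂ → ℂ) : Prop :=
  MeromorphicNFOn g Set.univ ∧ Set.EqOn g f U

open Classical in
/-- The meromorphic extension of `f|_U` to `ℂ` (and `0` if there is none). -/
def meromorphicExtension (U : Set ℂ) (f : ℂ → ℂ) : ℂ → ℂ :=
  if h : ∃ g, IsMeromorphicExtension U f g then Classical.choose h else 0

open Classical in
/-- `B{ν, κ}`: for fixed `ν - κ = N ∈ ℕ` the meromorphic extension in `κ` of the integral formula;
`0` if `ν - κ` is not a nonnegative integer. -/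
def tildeB (α : ℝ) (ν κ : ℂ) : ℂ :=
  if h : ∃ N : ℕ, ν - κ = (N : ℂ) then
    meromorphicExtension domainB (integralB α (Classical.choose h)) κ
  else 0

open Classical in
/-- `A[ν, κ]`: for fixed `ν - κ = N ∈ ℕ` the meromorphic extension in `κ` of the integral formula;
`0` if `ν - κ` is not a nonnegative integer. -/
def tildeA (α : ℝ) (ν κ : ℂ) : ℂ :=
  if h : ∃ N : ℕ, ν - κ = (N : ℂ) then
    meromorphicExtension (domainA α (Classical.choose h)) (integralA α (Classical.choose h)) κ
  else 0

/-- `f` and `g` are meromorphic on `ℂ` and equal as meromorphic functions, that is, they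
have the same values outside a closed discrete set. -/
def EqAsMeromorphic (f g : ℂ → ℂ) : Prop :=
  MeromorphicOn f Set.univ ∧ MeromorphicOn g Set.univ ∧ f =ᶠ[Filter.codiscrete ℂ] g

end BetaPrime

end

noncomputable section

namespace BetaPrime

open Filter Topology Set MeasureTheory

/-! ### Generic points of the complex plane -/

/-! Strip the Gamma factors from the two families: B{P+i, P} = b_i(P)/Γ(P) and A[P, P-j] = Γ(P+1)
a_j(P), where b_i and a_j are rescaled moments of powers of cos against powers of F, over the real
interval and over the imaginary axis. With G(P, Q, i, j) = (P+Q)/2 · b_i(P) a_j(Q) and D = 1/α,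
every summand on the left of both identities is a value G(P, P-2D, i, j), and every summand on the
right is a diagonal value G(P, P, i, j) (`eventually_shifted_product_eq`, `eventually_product_eq`).

Since F' = cos^(α-1), one explicit antiderivative (`hasDerivAt_primitive`) whose boundary values
vanish gives P b_i(P) - (P+D) b_i(P+2D) = b_{i-2}(P+2)/(P+1) and P a_j(P) - (P-D) a_j(P-2D) =
a_{j-2}(P-2)/(P-1), with right-hand side 0 when the index is below 2. Multiply the second by b_i(P),
and the first, with i+2 for i and P-2 for P, by a_{j-2}(P-2): the right-hand sides coincide. This
yields `mixedTerm_relation`, which exchanges an off-diagonal value of G for two diagonal values and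
an off-diagonal one at P-2+2D.

Summed along a chain of steps of 2, the diagonal values telescope. The off-diagonal sum becomes one
diagonal term plus a shorter off-diagonal sum at a shifted argument, and induction on the length
gives both identities (`sum_eq_sum_diagonal`, `sum_up_eq_sum_diagonal`).

The same relations, solved for b_i(P) and for a_j(P-2D), drive the meromorphic continuation
(`exists_meromorphic_of_shift`). All later identities are asserted on codiscrete sets: these are
stable under translation and finite intersection, and agreement on a half-plane spreads to them. -/

theorem eventually_codiscrete_iff {p : ℂ → Prop} :
    (∀ᶠ z in codiscrete ℂ, p z) ↔ ∀ x, ∀ᶠ z in 𝓝[≠] x, p z := by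
  change {z | p z} ∈ codiscrete ℂ ↔ _
  rw [mem_codiscrete]
  simp only [disjoint_principal_right, compl_compl]
  rfl

theorem eventually_codiscrete_add {p : ℂ → Prop} (h : ∀ᶠ z in codiscrete ℂ, p z) (c : ℂ) :
    ∀ᶠ z in codiscrete ℂ, p (z + c) := by
  rw [eventually_codiscrete_iff] at h ⊢
  intro x
  have ht : Tendsto (fun z : ℂ => z + c) (𝓝[≠] x) (𝓝[≠] (x + c)) := by
    refine tendsto_nhdsWithin_iff.2 ⟨?_, ?_⟩
    · exact ((continuous_id.add continuous_const).tendsto x).mono_left nhdsWithin_le_nhds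
    · filter_upwards [self_mem_nhdsWithin] with z hz
      simpa using hz
  exact ht.eventually (h (x + c))

theorem eventually_codiscrete_ne (c : ℂ) : ∀ᶠ z in codiscrete ℂ, z ≠ c := by
  rw [eventually_codiscrete_iff]
  intro x
  by_cases h : x = c
  · subst h; exact self_mem_nhdsWithin
  · exact (isOpen_ne.eventually_mem h).filter_mono nhdsWithin_le_nhds

/-- Identity theorem through orders: the plane is connected, so infinite order of `f - g` at one
point of `U` forces infinite order everywhere. -/
theorem eventually_codiscrete_eq_of_eqOn {f g : ℂ → ℂ} {U : Set ℂ} (hf : Meromorphic f)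
    (hg : Meromorphic g) (hU : IsOpen U) (hne : U.Nonempty) (h : EqOn f g U) :
    ∀ᶠ z in codiscrete ℂ, f z = g z := by
  have hfg : Meromorphic (f - g) := hf.sub hg
  obtain ⟨u, hu⟩ := hne
  have htop : meromorphicOrderAt (f - g) u = ⊤ := by
    rw [meromorphicOrderAt_eq_top_iff]
    refine Eventually.filter_mono nhdsWithin_le_nhds ?_
    filter_upwards [hU.mem_nhds hu] with z hz
    simp [h hz]
  rw [eventually_codiscrete_iff]
  intro x
  have hx : meromorphicOrderAt (f - g) x = ⊤ := by
    by_contra hx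
    exact (hfg.exists_meromorphicOrderAt_ne_top_iff_forall.1 ⟨x, hx⟩) u htop
  rw [meromorphicOrderAt_eq_top_iff] at hx
  filter_upwards [hx] with z hz
  exact sub_eq_zero.1 hz

/-- `Complex.Gamma` takes the value 0 at its poles, so this condition removes exactly the poles.
They are isolated because 1/Γ is entire and not identically zero. -/
theorem eventually_codiscrete_Gamma_ne_zero :
    ∀ᶠ z in codiscrete ℂ, Complex.Gamma z ≠ 0 := by
  have h : ∀ᶠ z in codiscrete ℂ, (Complex.Gamma z)⁻¹ ≠ 0 := by
    rw [eventually_codiscrete_iff]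
    intro x
    have ha : AnalyticOnNhd ℂ (fun z => (Complex.Gamma z)⁻¹) univ :=
      Complex.analyticOnNhd_univ_iff_differentiable.2 Complex.differentiable_one_div_Gamma
    by_contra hx
    have h0 : ∃ᶠ z in 𝓝[≠] x, (Complex.Gamma z)⁻¹ = (fun _ => (0 : ℂ)) z := by
      intro hh
      exact hx hh
    have := ha.eqOn_of_preconnected_of_frequently_eq analyticOnNhd_const
      isPreconnected_univ (mem_univ x) h0 (mem_univ (1 : ℂ))
    simp at this
  filter_upwards [h] with z hz
  simpa using hz

theorem Meromorphic.add_const {f : ℂ → ℂ} (hf : Meromorphic f) (c : ℂ) :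
    Meromorphic (fun z => f (z + c)) :=
  Meromorphic.meromorphic_fun_comp_add_const_iff_meromorphic.2 hf

theorem meromorphic_id : Meromorphic (fun z : ℂ => z) := fun _ => analyticAt_id.meromorphicAt

theorem isOpen_re_gt (σ : ℝ) : IsOpen {z : ℂ | σ < z.re} :=
  isOpen_lt continuous_const Complex.continuous_re

/-! ### Meromorphic continuation -/

/-- The iterates of the functional equation `f z = r z * f (z + δ) + h z`. -/
def shiftIterate (f r h : ℂ → ℂ) (δ : ℝ) : ℕ → ℂ → ℂ
  | 0 => f
  | n + 1 => fun z => r z * shiftIterate f r h δ n (z + δ) + h z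

/-- Each use of the functional equation moves the boundary of the half-plane of meromorphy to the
left by `δ`. Successive iterates agree where both are controlled, so they glue. -/
theorem exists_meromorphic_of_shift {f r h : ℂ → ℂ} {σ δ : ℝ} (hδ : 0 < δ)
    (hf : DifferentiableOn ℂ f {z | σ < z.re}) (hr : Meromorphic r) (hh : Meromorphic h)
    (heq : ∀ z : ℂ, σ < z.re → f z = r z * f (z + δ) + h z) :
    ∃ g : ℂ → ℂ, Meromorphic g ∧ EqOn g f {z | σ < z.re} := by
  set F := shiftIterate f r h δ with hF
  have hmero : ∀ n : ℕ, ∀ z : ℂ, σ - n * δ < z.re → MeromorphicAt (F n) z := by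
    intro n
    induction n with
    | zero =>
      intro z hz
      exact (hf.analyticAt ((isOpen_re_gt σ).mem_nhds (by simpa using hz))).meromorphicAt
    | succ n ih =>
      intro z hz
      have h1 : MeromorphicAt (fun z => F n (z + δ)) z := by
        rw [meromorphicAt_fun_comp_add_const_iff_meromorphicAt]
        apply ih
        push_cast at hz
        simp
        linarith
      exact ((hr z).mul h1).add (hh z)
  have hstep : ∀ n : ℕ, ∀ z : ℂ, σ - n * δ < z.re → F (n + 1) z = F n z := by
    intro n
    induction n with
    | zero =>
      intro z hz
      exact (heq z (by simpa using hz)).symm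
    | succ n ih =>
      intro z hz
      have := ih (z + δ) (by push_cast at hz; simp; linarith)
      change r z * F (n + 1) (z + δ) + h z = r z * F n (z + δ) + h z
      rw [this]
  have hle : ∀ n m : ℕ, n ≤ m → ∀ z : ℂ, σ - n * δ < z.re → F m z = F n z := by
    intro n m hnm
    induction m, hnm using Nat.le_induction with
    | base => intro z _; rfl
    | succ m hm ih =>
      intro z hz
      rw [← ih z hz]
      refine hstep m z (lt_of_le_of_lt ?_ hz)
      have : (n : ℝ) ≤ m := by exact_mod_cast hm
      nlinarith
  have hceil : ∀ z : ℂ, σ - ((⌈(σ - z.re) / δ⌉₊ + 1 : ℕ) : ℝ) * δ < z.re := by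
    intro z
    have h1 : (σ - z.re) / δ < ((⌈(σ - z.re) / δ⌉₊ + 1 : ℕ) : ℝ) := by
      push_cast
      linarith [Nat.le_ceil ((σ - z.re) / δ)]
    rw [div_lt_iff₀ hδ] at h1
    linarith
  -- The number of shifts carrying `z` beyond `σ`; the extra 1 makes the inequality strict, so one
  -- and the same iterate serves on a whole neighbourhood of `z`.
  set g : ℂ → ℂ := fun z => F (⌈(σ - z.re) / δ⌉₊ + 1) z with hg
  have hgF : ∀ n : ℕ, ∀ z : ℂ, σ - n * δ < z.re → g z = F n z := by
    intro n z hz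
    rcases le_total n (⌈(σ - z.re) / δ⌉₊ + 1) with h1 | h1
    · exact hle _ _ h1 z hz
    · exact (hle _ _ h1 z (hceil z)).symm
  refine ⟨g, fun z => ?_, fun z hz => ?_⟩
  · refine (hmero _ z (hceil z)).congr (Eventually.filter_mono nhdsWithin_le_nhds ?_)
    filter_upwards [(isOpen_re_gt _).mem_nhds (hceil z)] with w hw
    exact (hgF _ w hw).symm
  · exact hgF 0 z (by simpa using hz)

/-- Passing to normal form leaves the value unchanged at points of analyticity, so agreement with
`f` on `U` survives. -/
theorem IsMeromorphicExtension.toMeromorphicNFOn {f g : ℂ → ℂ} {U : Set ℂ} (hg : Meromorphic g)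
    (ha : ∀ z ∈ U, AnalyticAt ℂ g z) (h : EqOn g f U) :
    IsMeromorphicExtension U f (toMeromorphicNFOn g univ) := by
  refine ⟨meromorphicNFOn_toMeromorphicNFOn g univ, fun z hz => ?_⟩
  rw [toMeromorphicNFOn_eq_toMeromorphicNFAt hg.meromorphicOn (mem_univ z),
    toMeromorphicNFAt_eq_self.2 (ha z hz).meromorphicNFAt, h hz]

theorem isMeromorphicExtension_meromorphicExtension {f g : ℂ → ℂ} {U : Set ℂ}
    (h : IsMeromorphicExtension U f g) :
    IsMeromorphicExtension U f (meromorphicExtension U f) := by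
  have hex : ∃ g, IsMeromorphicExtension U f g := ⟨g, h⟩
  rw [meromorphicExtension, dif_pos hex]
  exact Classical.choose_spec hex

theorem tildeB_add_natCast (α : ℝ) (N : ℕ) (κ : ℂ) :
    tildeB α (κ + N) κ = meromorphicExtension domainB (integralB α N) κ := by
  have h : ∃ M : ℕ, κ + N - κ = (M : ℂ) := ⟨N, by ring⟩
  have hN : Classical.choose h = N := by
    have := (add_sub_cancel_left κ (N : ℂ)).symm.trans (Classical.choose_spec h)
    exact_mod_cast this.symm
  rw [tildeB, dif_pos h, hN]

theorem tildeA_add_natCast (α : ℝ) (N : ℕ) (κ : ℂ) :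
    tildeA α (κ + N) κ = meromorphicExtension (domainA α N) (integralA α N) κ := by
  have h : ∃ M : ℕ, κ + N - κ = (M : ℂ) := ⟨N, by ring⟩
  have hN : Classical.choose h = N := by
    have := (add_sub_cancel_left κ (N : ℂ)).symm.trans (Classical.choose_spec h)
    exact_mod_cast this.symm
  rw [tildeA, dif_pos h, hN]

/-! ### Solving the three-term relations -/

section Recursion

variable {G : ℂ → ℂ → ℕ → ℕ → ℂ} {D : ℂ} {r : ℕ}

/-- Telescoping: `h1` applied to each summand but the last produces diagonal values that cancel in
consecutive pairs, and `h2` closes the chain at second index `r`. The surviving off-diagonal values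
again have the form G(Q, Q-2D), with Q displaced by -2+2D. -/
theorem sum_eq_add_sum_shift
    (h1 : ∀ i j, ∀ᶠ P in codiscrete ℂ, G P (P - 2 * D) i (j + 2) = G P P i (j + 2)
      - G (P - 2) (P - 2) (i + 2) j + G (P - 2 + 2 * D) (P - 2) (i + 2) j)
    (h2 : ∀ i, ∀ᶠ P in codiscrete ℂ, G P (P - 2 * D) i r = G P P i r) (n : ℕ) (a : ℕ) :
    ∀ᶠ d in codiscrete ℂ,
      ∑ t ∈ Finset.range (n + 2), G (d - 2 * t) (d - 2 * t - 2 * D) (a + 2 * t) (r + 2 * (n + 1 - t))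
      = G d d a (r + 2 * n + 2) + ∑ t ∈ Finset.range (n + 1),
          G (d - 2 + 2 * D - 2 * t) (d - 2 + 2 * D - 2 * t - 2 * D) (a + 2 + 2 * t)
            (r + 2 * (n - t)) := by
  have peel : ∀ (m a : ℕ) (d : ℂ),
      ∑ t ∈ Finset.range (m + 2), G (d - 2 * t) (d - 2 * t - 2 * D) (a + 2 * t)
        (r + 2 * (m + 1 - t))
      = G d (d - 2 * D) a (r + 2 * m + 2) + ∑ t ∈ Finset.range (m + 1),
          G (d - 2 - 2 * t) (d - 2 - 2 * t - 2 * D) (a + 2 + 2 * t) (r + 2 * (m - t)) := by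
    intro m a d
    rw [Finset.sum_range_succ', add_comm]
    congr 1
    · simp; congr 1
    · refine Finset.sum_congr rfl fun t _ => ?_
      rw [show d - 2 * ((t + 1 : ℕ) : ℂ) = d - 2 - 2 * t by push_cast; ring,
        show a + 2 * (t + 1) = a + 2 + 2 * t by ring, Nat.add_sub_add_right]
  induction n generalizing a with
  | zero =>
    filter_upwards [h1 a r, eventually_codiscrete_add (h2 (a + 2)) (-2)] with d hd1 hd2
    rw [peel]
    simp only [← sub_eq_add_neg] at hd2
    simp only [Nat.add_zero, hd1, zero_add, Finset.sum_range_one, Nat.cast_zero,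
      mul_zero, sub_zero, Nat.sub_self, hd2]
    rw [show d - 2 + 2 * D - 2 * D = d - 2 by ring]
    ring
  | succ n ih =>
    filter_upwards [h1 a (r + 2 * (n + 1)), eventually_codiscrete_add (ih (a + 2)) (-2)]
      with d hd1 hd2
    simp only [← sub_eq_add_neg] at hd2
    rw [peel, hd1, hd2, peel, show d - 2 + 2 * D - 2 * D = d - 2 by ring,
      show d - 2 - 2 + 2 * D = d - 2 + 2 * D - 2 by ring]
    rw [show r + 2 * (n + 1) = r + 2 * n + 2 by ring]
    ring

theorem sum_eq_sum_diagonal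
    (h1 : ∀ i j, ∀ᶠ P in codiscrete ℂ, G P (P - 2 * D) i (j + 2) = G P P i (j + 2)
      - G (P - 2) (P - 2) (i + 2) j + G (P - 2 + 2 * D) (P - 2) (i + 2) j)
    (h2 : ∀ i, ∀ᶠ P in codiscrete ℂ, G P (P - 2 * D) i r = G P P i r) (n : ℕ) (a : ℕ) :
    ∀ᶠ d in codiscrete ℂ,
      ∑ t ∈ Finset.range (n + 1), G (d - 2 * t) (d - 2 * t - 2 * D) (a + 2 * t) (r + 2 * (n - t))
      = ∑ t ∈ Finset.range (n + 1), G (d - 2 * t + 2 * t * D) (d - 2 * t + 2 * t * D) (a + 2 * t)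
          (r + 2 * (n - t)) := by
  induction n generalizing a with
  | zero =>
    filter_upwards [h2 a] with d hd
    simp [hd]
  | succ n ih =>
    filter_upwards [sum_eq_add_sum_shift h1 h2 n a,
      eventually_codiscrete_add (ih (a + 2)) (-2 + 2 * D)] with d hd1 hd2
    rw [show d + (-2 + 2 * D) = d - 2 + 2 * D by ring] at hd2
    rw [hd1, hd2, Finset.sum_range_succ' _ (n + 1), add_comm]
    congr 1
    · refine Finset.sum_congr rfl fun t _ => ?_
      rw [show d - 2 * ((t + 1 : ℕ) : ℂ) + 2 * ((t + 1 : ℕ) : ℂ) * D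
          = d - 2 + 2 * D - 2 * t + 2 * t * D by push_cast; ring,
        show a + 2 * (t + 1) = a + 2 + 2 * t by ring, Nat.add_sub_add_right]
    · simp; congr 1

/-- The same telescoping in the other direction. The chain now ends where the first index is `r`, so
`h3` replaces `h2`, and the lower end contributes a boundary pair at `d`. -/
theorem sum_up_eq_add_sum_shift
    (h1 : ∀ i j, ∀ᶠ P in codiscrete ℂ, G P (P - 2 * D) i (j + 2) = G P P i (j + 2)
      - G (P - 2) (P - 2) (i + 2) j + G (P - 2 + 2 * D) (P - 2) (i + 2) j)
    (h3 : ∀ j, ∀ᶠ P in codiscrete ℂ, G (P + 2 * D) P r j = G P P r j) (n : ℕ) (b : ℕ) :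
    ∀ᶠ d in codiscrete ℂ,
      ∑ t ∈ Finset.range n, G (d + 2 * (t + 1)) (d + 2 * (t + 1) - 2 * D) (r + 2 * (n - 1 - t))
        (b + 2 * (t + 1))
      = G (d + 2 * D) d (r + 2 * n) b - G d d (r + 2 * n) b
        + ∑ t ∈ Finset.range n, G (d + 2 * D + 2 * (t + 1)) (d + 2 * D + 2 * (t + 1) - 2 * D)
            (r + 2 * (n - 1 - t)) (b + 2 * (t + 1)) := by
  have peel : ∀ (m b : ℕ) (d : ℂ),
      ∑ t ∈ Finset.range (m + 1), G (d + 2 * (t + 1)) (d + 2 * (t + 1) - 2 * D)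
        (r + 2 * (m + 1 - 1 - t)) (b + 2 * (t + 1))
      = G (d + 2) (d + 2 - 2 * D) (r + 2 * m) (b + 2) + ∑ t ∈ Finset.range m,
          G (d + 2 + 2 * (t + 1)) (d + 2 + 2 * (t + 1) - 2 * D)
            (r + 2 * (m - 1 - t)) (b + 2 + 2 * (t + 1)) := by
    intro m b d
    rw [Finset.sum_range_succ', add_comm]
    congr 1
    · simp
    · refine Finset.sum_congr rfl fun t _ => ?_
      rw [show d + 2 * (((t + 1 : ℕ) : ℂ) + 1) = d + 2 + 2 * (t + 1) by push_cast; ring,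
        show b + 2 * (t + 1 + 1) = b + 2 + 2 * (t + 1) by ring,
        show m + 1 - 1 - (t + 1) = m - 1 - t by omega]
  induction n generalizing b with
  | zero =>
    filter_upwards [h3 b] with d hd
    simp [hd]
  | succ n ih =>
    filter_upwards [eventually_codiscrete_add (h1 (r + 2 * n) b) 2,
      eventually_codiscrete_add (ih (b + 2)) 2] with d hd1 hd2
    rw [peel, hd1, hd2, peel, show d + 2 * D + 2 - 2 * D = d + 2 by ring,
      show d + 2 - 2 = d by ring, show d + 2 * D + 2 = d + 2 + 2 * D by ring,
      show r + 2 * (n + 1) = r + 2 * n + 2 by ring]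
    ring

theorem sum_up_eq_sum_diagonal
    (h1 : ∀ i j, ∀ᶠ P in codiscrete ℂ, G P (P - 2 * D) i (j + 2) = G P P i (j + 2)
      - G (P - 2) (P - 2) (i + 2) j + G (P - 2 + 2 * D) (P - 2) (i + 2) j)
    (h3 : ∀ j, ∀ᶠ P in codiscrete ℂ, G (P + 2 * D) P r j = G P P r j) (n : ℕ) (b : ℕ) :
    ∀ᶠ d in codiscrete ℂ,
      ∑ t ∈ Finset.range n, G (d + 2 * (t + 1)) (d + 2 * (t + 1) - 2 * D) (r + 2 * (n - 1 - t))
        (b + 2 * (t + 1))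
      = ∑ t ∈ Finset.range n, G (d + 2 * (t + 1) - 2 * (t + 1) * D)
          (d + 2 * (t + 1) - 2 * (t + 1) * D) (r + 2 * (n - 1 - t)) (b + 2 * (t + 1)) := by
  induction n generalizing b with
  | zero => simp
  | succ n ih =>
    -- At d' = d+2-2D the off-diagonal boundary value is G(d+2, d+2-2D), precisely the first summand
    -- of the longer sum, and the shifted sum at d'+2D = d+2 is its remainder. What is left is the
    -- diagonal value at d' plus the shorter sum at d'.
    filter_upwards [eventually_codiscrete_add (sum_up_eq_add_sum_shift h1 h3 n (b + 2)) (2 - 2 * D),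
      eventually_codiscrete_add (ih (b + 2)) (2 - 2 * D)] with d hd1 hd2
    rw [Finset.sum_range_succ', Finset.sum_range_succ' _ n]
    have e1 : ∀ t : ℕ, G (d + 2 * (((t + 1 : ℕ) : ℂ) + 1))
        (d + 2 * (((t + 1 : ℕ) : ℂ) + 1) - 2 * D) (r + 2 * (n + 1 - 1 - (t + 1)))
        (b + 2 * (t + 1 + 1)) = G (d + (2 - 2 * D) + 2 * D + 2 * (t + 1))
        (d + (2 - 2 * D) + 2 * D + 2 * (t + 1) - 2 * D) (r + 2 * (n - 1 - t))
        (b + 2 + 2 * (t + 1)) := by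
      intro t
      rw [show d + 2 * (((t + 1 : ℕ) : ℂ) + 1) = d + (2 - 2 * D) + 2 * D + 2 * (t + 1) by
        push_cast; ring, show b + 2 * (t + 1 + 1) = b + 2 + 2 * (t + 1) by ring,
        show n + 1 - 1 - (t + 1) = n - 1 - t by omega]
    have e2 : ∀ t : ℕ, G (d + 2 * (((t + 1 : ℕ) : ℂ) + 1) - 2 * (((t + 1 : ℕ) : ℂ) + 1) * D)
        (d + 2 * (((t + 1 : ℕ) : ℂ) + 1) - 2 * (((t + 1 : ℕ) : ℂ) + 1) * D)
        (r + 2 * (n + 1 - 1 - (t + 1)))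
        (b + 2 * (t + 1 + 1)) = G (d + (2 - 2 * D) + 2 * (t + 1) - 2 * (t + 1) * D)
        (d + (2 - 2 * D) + 2 * (t + 1) - 2 * (t + 1) * D) (r + 2 * (n - 1 - t))
        (b + 2 + 2 * (t + 1)) := by
      intro t
      rw [show d + 2 * (((t + 1 : ℕ) : ℂ) + 1) - 2 * (((t + 1 : ℕ) : ℂ) + 1) * D
        = d + (2 - 2 * D) + 2 * (t + 1) - 2 * (t + 1) * D by push_cast; ring,
        show b + 2 * (t + 1 + 1) = b + 2 + 2 * (t + 1) by ring,
        show n + 1 - 1 - (t + 1) = n - 1 - t by omega]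
    simp only [e1, e2]
    rw [← hd2, hd1]
    simp only [Nat.cast_zero, zero_add, mul_one, Nat.add_sub_cancel, Nat.sub_zero]
    rw [show d + (2 - 2 * D) + 2 * D = d + 2 by ring, show d + (2 - 2 * D) = d + 2 - 2 * D by ring]
    ring

end Recursion

theorem sum_filter_even_range {r : ℕ} (hr : r < 2) (n : ℕ) (f : ℕ → ℂ) :
    ∑ s ∈ (Finset.range (r + 2 * n + 1)).filter Even, f s
      = ∑ t ∈ Finset.range (n + 1), f (2 * t) := by
  refine Finset.sum_nbij' (fun s => s / 2) (fun t => 2 * t) ?_ ?_ ?_ ?_ ?_ <;>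
    simp only [Finset.mem_filter, Finset.mem_range, Nat.even_iff] <;> intro s hs
  · omega
  · omega
  · omega
  · omega
  · congr 1; omega

theorem sum_filter_even_Icc {r : ℕ} (hr : r < 2) (n : ℕ) (f : ℕ → ℂ) :
    ∑ s ∈ (Finset.Icc 2 (r + 2 * n)).filter Even, f s
      = ∑ t ∈ Finset.range n, f (2 * (t + 1)) := by
  refine Finset.sum_nbij' (fun s => s / 2 - 1) (fun t => 2 * (t + 1)) ?_ ?_ ?_ ?_ ?_ <;>
    simp only [Finset.mem_filter, Finset.mem_range, Finset.mem_Icc, Nat.even_iff] <;> intro s hs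
  · omega
  · omega
  · omega
  · omega
  · congr 1; omega

/-! ### Integrals depending holomorphically on an exponent -/

section Parameter

variable {T : Type*} [MeasurableSpace T] {μ : Measure T} {L : T → ℝ} {φ : T → ℂ} {σ₀ : ℝ}

theorem integrable_exp_mul (hL : Measurable L) (hφ : AEStronglyMeasurable φ μ)
    (hint : ∀ σ : ℝ, σ₀ < σ → Integrable (fun t => Real.exp (σ * L t) * ‖φ t‖) μ) {z : ℂ}
    (hz : σ₀ < z.re) : Integrable (fun t => Complex.exp (z * (L t : ℂ)) * φ t) μ := by
  have hm : Measurable fun t => Complex.exp (z * (L t : ℂ)) :=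
    Complex.measurable_exp.comp ((Complex.measurable_ofReal.comp hL).const_mul z)
  refine (hint z.re hz).mono (hm.aestronglyMeasurable.mul hφ) (Eventually.of_forall fun t => ?_)
  simp [Complex.norm_exp, abs_of_pos (Real.exp_pos _)]

/-- Differentiation under the integral. The factor `L` brought down by the derivative is absorbed by
giving up a little exponent: |L| exp(εL) ≤ 1/ε for L ≤ 0. -/
theorem differentiableOn_integral_exp_mul (hL : Measurable L) (hL0 : ∀ t, L t ≤ 0)
    (hφ : AEStronglyMeasurable φ μ)
    (hint : ∀ σ : ℝ, σ₀ < σ → Integrable (fun t => Real.exp (σ * L t) * ‖φ t‖) μ) :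
    DifferentiableOn ℂ (fun z : ℂ => ∫ t, Complex.exp (z * (L t : ℂ)) * φ t ∂μ)
      {z | σ₀ < z.re} := by
  intro z hz
  have hz : σ₀ < z.re := hz
  -- One ε for the neighbourhood of `z` and one to absorb `L`; the exponent Re z - 2ε of the
  -- dominating function still exceeds `σ₀`.
  set ε := (z.re - σ₀) / 3 with hε
  have hε0 : 0 < ε := by rw [hε]; linarith
  have hm : ∀ z : ℂ, AEStronglyMeasurable (fun t => Complex.exp (z * (L t : ℂ)) * φ t) μ := by
    intro z
    have hm : Measurable fun t => Complex.exp (z * (L t : ℂ)) :=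
      Complex.measurable_exp.comp ((Complex.measurable_ofReal.comp hL).const_mul z)
    exact hm.aestronglyMeasurable.mul hφ
  have key := hasDerivAt_integral_of_dominated_loc_of_deriv_le (μ := μ) (𝕜 := ℂ) (x₀ := z)
    (s := {w : ℂ | z.re - ε < w.re})
    (F := fun z t => Complex.exp (z * (L t : ℂ)) * φ t)
    (F' := fun z t => (L t : ℂ) * (Complex.exp (z * (L t : ℂ)) * φ t))
    (bound := fun t => ε⁻¹ * (Real.exp ((z.re - 2 * ε) * L t) * ‖φ t‖))
    ((isOpen_re_gt _).mem_nhds (by simp [hε0]))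
    (Eventually.of_forall hm) (integrable_exp_mul hL hφ hint hz)
    ((Complex.measurable_ofReal.comp hL).aestronglyMeasurable.mul (hm z))
    (Eventually.of_forall fun t w hw => ?_)
    ((hint _ (by rw [hε]; linarith)).const_mul _)
    (Eventually.of_forall fun t w _ => ?_)
  · exact key.2.differentiableAt.differentiableWithinAt
  · have hw : z.re - ε < w.re := hw
    have h1 : ‖(L t : ℂ) * (Complex.exp (w * (L t : ℂ)) * φ t)‖
        = -L t * (Real.exp (w.re * L t) * ‖φ t‖) := by
      simp [Complex.norm_exp, abs_of_nonpos (hL0 t)]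
    rw [h1]
    have h2 : Real.exp (w.re * L t) ≤ Real.exp ((z.re - ε) * L t) :=
      Real.exp_le_exp.2 (mul_le_mul_of_nonpos_right hw.le (hL0 t))
    have h3 : Real.exp ((z.re - ε) * L t) = Real.exp ((z.re - 2 * ε) * L t) * Real.exp (ε * L t) := by
      rw [← Real.exp_add]; congr 1; ring
    have h4 : -L t * Real.exp (ε * L t) ≤ ε⁻¹ := by
      have h5 := Real.add_one_le_exp (-(ε * L t))
      rw [Real.exp_neg] at h5
      have h6 := Real.exp_pos (ε * L t)
      have h7 : -(ε * L t) * Real.exp (ε * L t) ≤ 1 := by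
        calc -(ε * L t) * Real.exp (ε * L t)
            ≤ (Real.exp (ε * L t))⁻¹ * Real.exp (ε * L t) :=
              mul_le_mul_of_nonneg_right (by linarith) h6.le
          _ = 1 := inv_mul_cancel₀ h6.ne'
      rw [← one_div, le_div_iff₀ hε0]
      linarith
    calc -L t * (Real.exp (w.re * L t) * ‖φ t‖)
        ≤ -L t * (Real.exp ((z.re - ε) * L t) * ‖φ t‖) := by
          refine mul_le_mul_of_nonneg_left ?_ (by linarith [hL0 t])
          exact mul_le_mul_of_nonneg_right h2 (norm_nonneg _)
      _ = (-L t * Real.exp (ε * L t)) * (Real.exp ((z.re - 2 * ε) * L t) * ‖φ t‖) := by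
          rw [h3]; ring
      _ ≤ _ := mul_le_mul_of_nonneg_right h4 (by positivity)
  · have h1 : HasDerivAt (fun w : ℂ => w * (L t : ℂ)) (L t : ℂ) w := by
      simpa using (hasDerivAt_id w).mul_const (L t : ℂ)
    have := (h1.cexp).mul_const (φ t)
    exact this.congr_deriv (by ring)

end Parameter

/-! ### The antiderivative behind the three-term relations -/

/-- Here `ℓ` plays log cos, `S` plays sin, and `ε` is the direction of the contour: 1 on the real
interval, i on the imaginary axis. The second summand is chosen so that its derivative cancels the
cross term n cos^(p+α-1) sin F^(n-1) of the first; sin² = 1 - cos² does the rest. The truncated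
exponents n-1 and n-2 are harmless because their coefficients vanish when truncation occurs. -/
theorem hasDerivAt_primitive {ℓ S F : ℝ → ℂ} {ε α p : ℂ} {t : ℝ} (n : ℕ)
    (hp : n = 0 ∨ p + α ≠ 0)
    (hℓ : HasDerivAt ℓ (-ε * S t * Complex.exp (-ℓ t)) t)
    (hS : HasDerivAt S (ε * Complex.exp (ℓ t)) t)
    (hF : HasDerivAt F (ε * Complex.exp ((α - 1) * ℓ t)) t)
    (hSq : S t ^ 2 = 1 - Complex.exp (ℓ t) ^ 2) :
    HasDerivAt (fun t => Complex.exp (p * ℓ t) * S t * F t ^ n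
        + n / (p + α) * (Complex.exp ((p + α) * ℓ t) * F t ^ (n - 1)))
      (ε * ((1 + p) * (Complex.exp ((p + 1) * ℓ t) * F t ^ n)
        - p * (Complex.exp ((p - 1) * ℓ t) * F t ^ n)
        + n * (n - 1) / (p + α) * (Complex.exp ((p + 2 * α - 1) * ℓ t) * F t ^ (n - 2)))) t := by
  have hE : ∀ q : ℂ, HasDerivAt (fun t => Complex.exp (q * ℓ t))
      (Complex.exp (q * ℓ t) * (q * (-ε * S t * Complex.exp (-ℓ t)))) t := fun q =>
    (hℓ.const_mul q).cexp
  have h := (((hE p).mul hS).mul (hF.pow n)).add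
    (((hE (p + α)).mul (hF.pow (n - 1))).const_mul (n / (p + α)))
  refine HasDerivAt.congr_deriv h ?_
  set c := Complex.exp (ℓ t) with hc
  have hc0 : c ≠ 0 := Complex.exp_ne_zero _
  have e1 : Complex.exp (-ℓ t) = c⁻¹ := Complex.exp_neg _
  set A := Complex.exp (α * ℓ t)
  set E := Complex.exp (p * ℓ t)
  have e2 : Complex.exp ((α - 1) * ℓ t) = A * c⁻¹ := by
    rw [← e1, ← Complex.exp_add]; congr 1; ring
  have e3 : Complex.exp ((p + 1) * ℓ t) = E * c := by
    rw [← Complex.exp_add]; congr 1; ring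
  have e4 : Complex.exp ((p - 1) * ℓ t) = E * c⁻¹ := by
    rw [← e1, ← Complex.exp_add]; congr 1; ring
  have e5 : Complex.exp ((p + α) * ℓ t) = E * A := by
    rw [← Complex.exp_add]; congr 1; ring
  have e6 : Complex.exp ((p + 2 * α - 1) * ℓ t) = E * A * A * c⁻¹ := by
    rw [← e1, ← Complex.exp_add, ← Complex.exp_add, ← Complex.exp_add]; congr 1; ring
  simp only [Pi.mul_apply, Pi.pow_apply]
  rw [e1, e2, e3, e4, e5, e6]
  rcases n with _ | n
  · simp
    field_simp
    linear_combination (-ε * E * p) * hSq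
  · have hpα : p + α ≠ 0 := by simpa using hp
    have e7 : (n + 1 - 2 : ℕ) = n - 1 := by omega
    rw [e7, Nat.add_sub_cancel]
    push_cast
    field_simp
    rw [pow_succ]
    linear_combination (-ε * E * p * F t * (p + α) * F t ^ n) * hSq

/-! ### The real interval -/

theorem log_cos_nonpos (x : ℝ) : Real.log (Real.cos x) ≤ 0 := by
  rw [← Real.log_abs]
  exact Real.log_nonpos (abs_nonneg _) (Real.abs_cos_le_one x)

theorem measurable_log_cos : Measurable fun x : ℝ => Real.log (Real.cos x) :=
  Real.measurable_log.comp Real.measurable_cos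

theorem cosPow_ofReal (s : ℂ) {x : ℝ} (hx : |x| < Real.pi / 2) :
    cosPow s (x : ℂ) = Complex.exp (s * (Real.log (Real.cos x) : ℂ)) := by
  rw [cosPow, logCos_eq_log_cos _ (by simpa using hx), ← Complex.ofReal_cos,
    Complex.ofReal_log (Real.cos_pos_of_mem_Ioo ⟨by linarith [(abs_lt.1 hx).1], (abs_lt.1 hx).2⟩).le]

/-- By concavity cos x is at least 2/π times the distance to the nearer endpoint, so a negative
power is dominated by the sum of the corresponding powers of the two distances. -/
theorem integrableOn_exp_log_cos {σ : ℝ} (hσ : -1 < σ) :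
    IntegrableOn (fun x : ℝ => Real.exp (σ * Real.log (Real.cos x)))
      (Ioo (-(Real.pi / 2)) (Real.pi / 2)) := by
  have hpi := Real.pi_pos
  have hle : -(Real.pi / 2) ≤ Real.pi / 2 := by linarith
  -- Reduces to a nonpositive exponent, for which the lower bound on cos becomes an upper bound on
  -- its power.
  set τ := min σ 0 with hτ
  have hτ1 : -1 < τ := lt_min hσ (by norm_num)
  have hτ0 : τ ≤ 0 := min_le_right _ _
  have hmeas : Measurable fun x : ℝ => Real.exp (σ * Real.log (Real.cos x)) :=
    Real.measurable_exp.comp (measurable_log_cos.const_mul σ)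
  have i1 : IntervalIntegrable (fun x : ℝ => (Real.pi / 2 - x) ^ τ) volume
      (-(Real.pi / 2)) (Real.pi / 2) := by
    have := (intervalIntegral.intervalIntegrable_rpow' (a := 0) (b := Real.pi) hτ1).comp_sub_left
      (Real.pi / 2)
    have h2 := this.symm
    rwa [sub_zero, show Real.pi / 2 - Real.pi = -(Real.pi / 2) by ring] at h2
  have i2 : IntervalIntegrable (fun x : ℝ => (Real.pi / 2 + x) ^ τ) volume
      (-(Real.pi / 2)) (Real.pi / 2) := by
    have := (intervalIntegral.intervalIntegrable_rpow' (a := 0) (b := Real.pi) hτ1).comp_add_left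
      (Real.pi / 2)
    rwa [zero_sub, show Real.pi - Real.pi / 2 = Real.pi / 2 by ring] at this
  have i3 := ((i1.add i2).const_mul ((2 / Real.pi) ^ τ))
  rw [intervalIntegrable_iff_integrableOn_Ioo_of_le hle] at i3
  refine i3.mono' hmeas.aestronglyMeasurable ?_
  refine (ae_restrict_iff' measurableSet_Ioo).2 (Eventually.of_forall fun x hx => ?_)
  have hc := Real.cos_pos_of_mem_Ioo hx
  rw [Real.norm_of_nonneg (Real.exp_pos _).le]
  have h1 : Real.exp (σ * Real.log (Real.cos x)) ≤ Real.cos x ^ τ := by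
    rw [Real.rpow_def_of_pos hc, mul_comm (Real.log _)]
    exact Real.exp_le_exp.2 (mul_le_mul_of_nonpos_right (min_le_left _ _) (log_cos_nonpos x))
  refine h1.trans ?_
  have p1 : 0 < Real.pi / 2 - x := by linarith [hx.2]
  have p2 : 0 < Real.pi / 2 + x := by linarith [hx.1]
  have q : 0 < 2 / Real.pi := by positivity
  rw [mul_add, ← Real.mul_rpow q.le p1.le, ← Real.mul_rpow q.le p2.le]
  rcases le_total 0 x with h | h
  · have hb : 2 / Real.pi * (Real.pi / 2 - x) ≤ Real.cos x := by
      have := Real.one_sub_mul_le_cos h hx.2.le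
      have e : 2 / Real.pi * (Real.pi / 2 - x) = 1 - 2 / Real.pi * x := by field_simp
      linarith
    have := Real.rpow_le_rpow_of_nonpos (mul_pos q p1) hb hτ0
    have := Real.rpow_nonneg (mul_pos q p2).le τ
    linarith
  · have hb : 2 / Real.pi * (Real.pi / 2 + x) ≤ Real.cos x := by
      have := Real.one_add_mul_le_cos hx.1.le h
      have e : 2 / Real.pi * (Real.pi / 2 + x) = 1 + 2 / Real.pi * x := by field_simp
      linarith
    have := Real.rpow_le_rpow_of_nonpos (mul_pos q p2) hb hτ0
    have := Real.rpow_nonneg (mul_pos q p1).le τ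
    linarith

/-- The function `Ftilde α` on the interval `[-π/2, π/2]`. -/
def realF (α x : ℝ) : ℝ :=
  ∫ t in (-(Real.pi / 2))..x, Real.exp ((α - 1) * Real.log (Real.cos t))

variable {α : ℝ}

theorem intervalIntegrable_realF (hα : 0 < α) :
    IntervalIntegrable (fun t : ℝ => Real.exp ((α - 1) * Real.log (Real.cos t))) volume
      (-(Real.pi / 2)) (Real.pi / 2) := by
  rw [intervalIntegrable_iff_integrableOn_Ioo_of_le (by linarith [Real.pi_pos])]
  exact integrableOn_exp_log_cos (by linarith)

theorem continuousOn_realF (hα : 0 < α) :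
    ContinuousOn (realF α) (Icc (-(Real.pi / 2)) (Real.pi / 2)) := by
  have h := intervalIntegral.continuousOn_primitive_interval' (intervalIntegrable_realF hα)
    left_mem_uIcc
  rwa [uIcc_of_le (by linarith [Real.pi_pos])] at h

theorem exists_bound_realF (hα : 0 < α) :
    ∃ M : ℝ, ∀ x ∈ Icc (-(Real.pi / 2)) (Real.pi / 2), ‖(realF α x : ℂ)‖ ≤ M := by
  obtain ⟨M, hM⟩ := isCompact_Icc.exists_bound_of_continuousOn (continuousOn_realF hα)
  exact ⟨M, fun x hx => by simpa using hM x hx⟩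

theorem continuousAt_exp_log_cos {x : ℝ} (hx : x ∈ Ioo (-(Real.pi / 2)) (Real.pi / 2)) (s : ℝ) :
    ContinuousAt (fun t : ℝ => Real.exp (s * Real.log (Real.cos t))) x :=
  ((Real.continuous_cos.continuousAt.log (Real.cos_pos_of_mem_Ioo hx).ne').const_mul s).rexp

theorem hasDerivAt_realF (hα : 0 < α) {x : ℝ} (hx : x ∈ Ioo (-(Real.pi / 2)) (Real.pi / 2)) :
    HasDerivAt (realF α) (Real.exp ((α - 1) * Real.log (Real.cos x))) x := by
  have hm : Measurable fun t : ℝ => Real.exp ((α - 1) * Real.log (Real.cos t)) :=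
    Real.measurable_exp.comp (measurable_log_cos.const_mul _)
  refine intervalIntegral.integral_hasDerivAt_right ?_
    hm.stronglyMeasurable.stronglyMeasurableAtFilter (continuousAt_exp_log_cos hx _)
  refine (intervalIntegrable_realF hα).mono_set ?_
  rw [uIcc_of_le hx.1.le, uIcc_of_le (by linarith [Real.pi_pos])]
  exact Icc_subset_Icc_right hx.2.le

theorem Ftilde_ofReal (hα : 0 < α) {x : ℝ} (hx : x ∈ Ioo (-(Real.pi / 2)) (Real.pi / 2)) :
    Ftilde α (x : ℂ) = (realF α x : ℂ) := by
  have hpi := Real.pi_pos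
  have hmain : ∀ t : ℝ, |t| < Real.pi / 2 → cosPow ((α : ℂ) - 1) (t : ℂ)
      = ((Real.exp ((α - 1) * Real.log (Real.cos t)) : ℝ) : ℂ) := by
    intro t ht
    rw [cosPow_ofReal _ ht]
    push_cast
    rfl
  have h1 : ∫ t in (-(Real.pi / 2))..(0 : ℝ), cosPow ((α : ℂ) - 1) (t : ℂ)
      = ∫ t in (-(Real.pi / 2))..(0 : ℝ),
        ((Real.exp ((α - 1) * Real.log (Real.cos t)) : ℝ) : ℂ) := by
    rw [intervalIntegral.integral_of_le (by linarith), intervalIntegral.integral_of_le (by linarith)]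
    refine setIntegral_congr_fun measurableSet_Ioc fun t ht => hmain t ?_
    rw [abs_lt]
    exact ⟨ht.1, by linarith [ht.2]⟩
  have h2 : ∫ t in (0 : ℝ)..x, cosPow ((α : ℂ) - 1) (t : ℂ)
      = ∫ t in (0 : ℝ)..x, ((Real.exp ((α - 1) * Real.log (Real.cos t)) : ℝ) : ℂ) := by
    refine intervalIntegral.integral_congr fun t ht => hmain t ?_
    have h0 : (0 : ℝ) ∈ Ioo (-(Real.pi / 2)) (Real.pi / 2) := ⟨by linarith, by linarith⟩
    exact abs_lt.2 ((ordConnected_Ioo.uIcc_subset h0 hx) ht)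
  have hi : ∀ y ∈ Icc (-(Real.pi / 2)) (Real.pi / 2), ∀ z ∈ Icc (-(Real.pi / 2)) (Real.pi / 2),
      IntervalIntegrable (fun t : ℝ => Real.exp ((α - 1) * Real.log (Real.cos t))) volume y z := by
    intro y hy z hz
    refine (intervalIntegrable_realF hα).mono_set ?_
    rw [uIcc_of_le (by linarith : -(Real.pi / 2) ≤ Real.pi / 2)]
    exact ordConnected_Icc.uIcc_subset hy hz
  simp only [Ftilde, Complex.ofReal_im, Complex.ofReal_re, intervalIntegral.integral_same,
    Complex.ofReal_zero, mul_zero, add_zero]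
  rw [h1, h2, intervalIntegral.integral_ofReal, intervalIntegral.integral_ofReal,
    ← Complex.ofReal_add, realF]
  congr 1
  exact intervalIntegral.integral_add_adjacent_intervals
    (hi _ ⟨le_rfl, by linarith⟩ _ ⟨by linarith, by linarith⟩)
    (hi _ ⟨by linarith, by linarith⟩ _ (Ioo_subset_Icc_self hx))

/-- The moments `∫ (cos x) ^ s (F x) ^ n dx` over the real interval. -/
def realMoment (α : ℝ) (n : ℕ) (s : ℂ) : ℂ :=
  ∫ x in Ioo (-(Real.pi / 2)) (Real.pi / 2),
    Complex.exp (s * (Real.log (Real.cos x) : ℂ)) * (realF α x : ℂ) ^ n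

theorem aestronglyMeasurable_realF (hα : 0 < α) (n : ℕ) :
    AEStronglyMeasurable (fun x : ℝ => (realF α x : ℂ) ^ n)
      (volume.restrict (Ioo (-(Real.pi / 2)) (Real.pi / 2))) := by
  refine ContinuousOn.aestronglyMeasurable ?_ measurableSet_Ioo
  exact (Complex.continuous_ofReal.comp_continuousOn
    ((continuousOn_realF hα).mono Ioo_subset_Icc_self)).pow n

theorem integrable_exp_log_cos_mul_norm (hα : 0 < α) (n : ℕ) (σ : ℝ) (hσ : -1 < σ) :
    Integrable (fun x : ℝ => Real.exp (σ * Real.log (Real.cos x)) * ‖(realF α x : ℂ) ^ n‖)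
      (volume.restrict (Ioo (-(Real.pi / 2)) (Real.pi / 2))) := by
  obtain ⟨M, hM⟩ := exists_bound_realF hα
  refine (integrableOn_exp_log_cos hσ).mul_bdd (c := M ^ n)
    (aestronglyMeasurable_realF hα n).norm ?_
  refine (ae_restrict_iff' measurableSet_Ioo).2 (Eventually.of_forall fun x hx => ?_)
  rw [norm_norm, norm_pow]
  exact pow_le_pow_left₀ (norm_nonneg _) (hM x (Ioo_subset_Icc_self hx)) n

theorem integrableOn_realMoment (hα : 0 < α) (n : ℕ) {s : ℂ} (hs : -1 < s.re) :
    IntegrableOn (fun x : ℝ => Complex.exp (s * (Real.log (Real.cos x) : ℂ)) * (realF α x : ℂ) ^ n)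
      (Ioo (-(Real.pi / 2)) (Real.pi / 2)) :=
  integrable_exp_mul measurable_log_cos (aestronglyMeasurable_realF hα n)
    (integrable_exp_log_cos_mul_norm hα n) hs

theorem differentiableOn_realMoment (hα : 0 < α) (n : ℕ) :
    DifferentiableOn ℂ (realMoment α n) {s | -1 < s.re} :=
  differentiableOn_integral_exp_mul measurable_log_cos log_cos_nonpos
    (aestronglyMeasurable_realF hα n) (integrable_exp_log_cos_mul_norm hα n)

theorem integrandB_eq (hα : 0 < α) (N : ℕ) (κ : ℂ) {x : ℝ}
    (hx : x ∈ Ioo (-(Real.pi / 2)) (Real.pi / 2)) :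
    integrandB α N κ x = Complex.exp (((α : ℂ) * κ - 1) * (Real.log (Real.cos x) : ℂ))
      * (realF α x : ℂ) ^ N := by
  rw [integrandB, cosPow_ofReal _ (abs_lt.2 hx), Ftilde_ofReal hα hx]

theorem intervalIntegrable_integrandB (hα : 0 < α) (N : ℕ) {κ : ℂ} (hκ : 0 < κ.re) :
    IntervalIntegrable (integrandB α N κ) volume (-(Real.pi / 2)) (Real.pi / 2) := by
  rw [intervalIntegrable_iff_integrableOn_Ioo_of_le (by linarith [Real.pi_pos])]
  refine (integrableOn_realMoment hα N (s := (α : ℂ) * κ - 1) ?_).congr_fun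
    (fun x hx => (integrandB_eq hα N κ hx).symm) measurableSet_Ioo
  simp
  positivity

theorem integral_integrandB (hα : 0 < α) (N : ℕ) (κ : ℂ) :
    ∫ x in (-(Real.pi / 2))..(Real.pi / 2), integrandB α N κ x
      = realMoment α N ((α : ℂ) * κ - 1) := by
  rw [intervalIntegral.integral_of_le (by linarith [Real.pi_pos]), integral_Ioc_eq_integral_Ioo]
  exact setIntegral_congr_fun measurableSet_Ioo fun x hx => integrandB_eq hα N κ hx

theorem tendsto_exp_log_cos_zero {s : ℂ} (hs : 0 < s.re) {a : ℝ} {u : Set ℝ}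
    (ha : Real.cos a = 0) (hu : ∀ᶠ x in 𝓝[u] a, 0 < Real.cos x) :
    Tendsto (fun x : ℝ => Complex.exp (s * (Real.log (Real.cos x) : ℂ))) (𝓝[u] a) (𝓝 0) := by
  rw [tendsto_zero_iff_norm_tendsto_zero]
  have h1 : Tendsto (fun x : ℝ => Real.log (Real.cos x)) (𝓝[u] a) atBot := by
    refine Real.tendsto_log_nhdsGT_zero.comp (tendsto_nhdsWithin_iff.2 ⟨?_, hu⟩)
    rw [← ha]
    exact Real.continuous_cos.continuousAt.continuousWithinAt
  have h2 := Real.tendsto_exp_atBot.comp (h1.const_mul_atBot hs)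
  refine h2.congr fun x => ?_
  simp [Complex.norm_exp]

/-- The fundamental theorem of calculus for `hasDerivAt_primitive`; both boundary terms vanish since
cos^p and cos^(p+α) tend to 0 while sin and F stay bounded. -/
theorem realMoment_relation (hα : 0 < α) (n : ℕ) {p : ℂ} (hp : 0 < p.re) :
    (1 + p) * realMoment α n (p + 1) - p * realMoment α n (p - 1)
      + n * (n - 1) / (p + α) * realMoment α (n - 2) (p + 2 * α - 1) = 0 := by
  have hpi := Real.pi_pos
  have hpα : 0 < (p + α).re := by simp; linarith
  have hne : p + α ≠ 0 := fun h => by rw [h] at hpα; simp at hpα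
  set W : ℝ → ℂ := fun t => Complex.exp (p * (Real.log (Real.cos t) : ℂ)) * (Real.sin t : ℂ)
      * (realF α t : ℂ) ^ n
    + n / (p + α) * (Complex.exp ((p + α) * (Real.log (Real.cos t) : ℂ))
      * (realF α t : ℂ) ^ (n - 1)) with hW
  have hderiv : ∀ x ∈ Ioo (-(Real.pi / 2)) (Real.pi / 2), HasDerivAt W _ x := fun x hx => by
    have hc := Real.cos_pos_of_mem_Ioo hx
    have hexp : Complex.exp (Real.log (Real.cos x) : ℂ) = (Real.cos x : ℂ) := by
      rw [← Complex.ofReal_exp, Real.exp_log hc]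
    refine hasDerivAt_primitive (ε := 1) n (Or.inr hne)
      (ℓ := fun t => (Real.log (Real.cos t) : ℂ))
      (S := fun t => (Real.sin t : ℂ)) (F := fun t => (realF α t : ℂ)) (p := p) ?_ ?_ ?_ ?_
    · have := ((Real.hasDerivAt_cos x).log hc.ne').ofReal_comp
      convert this using 1
      rw [Complex.exp_neg, hexp]
      push_cast
      ring
    · rw [hexp, one_mul]
      exact (Real.hasDerivAt_sin x).ofReal_comp
    · have := (hasDerivAt_realF hα hx).ofReal_comp
      convert this using 1
      push_cast
      ring
    · rw [hexp]
      have := Real.sin_sq_add_cos_sq x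
      rw [eq_sub_iff_add_eq]
      exact_mod_cast this
  have hbd : ∀ (m : ℕ) (q : ℂ), 0 < q.re → ∀ (a : ℝ) (u : Set ℝ), Real.cos a = 0 →
      (∀ᶠ x in 𝓝[u] a, x ∈ Ioo (-(Real.pi / 2)) (Real.pi / 2)) →
      Tendsto (fun x : ℝ => Complex.exp (q * (Real.log (Real.cos x) : ℂ)) * (realF α x : ℂ) ^ m)
        (𝓝[u] a) (𝓝 0) := by
    intro m q hq a u ha hu
    obtain ⟨M, hM⟩ := exists_bound_realF hα
    refine (tendsto_exp_log_cos_zero hq ha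
      (hu.mono fun x hx => Real.cos_pos_of_mem_Ioo hx)).zero_mul_isBoundedUnder_le ?_
    refine isBoundedUnder_of_eventually_le (a := M ^ m) (hu.mono fun x hx => ?_)
    simp only [Function.comp_apply, norm_pow]
    exact pow_le_pow_left₀ (norm_nonneg _) (hM x (Ioo_subset_Icc_self hx)) m
  have hlim : ∀ (a : ℝ) (u : Set ℝ), Real.cos a = 0 →
      (∀ᶠ x in 𝓝[u] a, x ∈ Ioo (-(Real.pi / 2)) (Real.pi / 2)) →
      Tendsto W (𝓝[u] a) (𝓝 0) := by
    intro a u ha hu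
    have h1 := hbd n p hp a u ha hu
    have h2 := (hbd (n - 1) (p + α) hpα a u ha hu).const_mul (n / (p + α))
    have h3 : Tendsto (fun x : ℝ => Complex.exp (p * (Real.log (Real.cos x) : ℂ))
        * (realF α x : ℂ) ^ n * (Real.sin x : ℂ)) (𝓝[u] a) (𝓝 0) := by
      refine h1.zero_mul_isBoundedUnder_le ?_
      refine isBoundedUnder_of_eventually_le (a := 1) (Eventually.of_forall fun x => ?_)
      rw [Function.comp_apply, Complex.norm_real]
      exact Real.abs_sin_le_one x
    have h4 := h3.add h2
    simp only [mul_zero, add_zero] at h4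
    refine h4.congr fun x => ?_
    simp only [hW]
    ring
  have i1 := integrableOn_realMoment hα n (s := p + 1) (by simp; linarith)
  have i2 := integrableOn_realMoment hα n (s := p - 1) (by simp; linarith)
  have i3 := integrableOn_realMoment hα (n - 2) (s := p + 2 * α - 1) (by simp; linarith)
  have i4 := (((i1.const_mul (1 + p)).sub (i2.const_mul p)).add
    (i3.const_mul (n * (n - 1) / (p + α)))).const_mul 1
  have hI := intervalIntegral.integral_eq_sub_of_hasDerivAt_of_tendsto (by linarith) hderiv
    ((intervalIntegrable_iff_integrableOn_Ioo_of_le (by linarith)).2 i4)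
    (hlim _ (Ioi _) (by simp) (Ioo_mem_nhdsGT (by linarith)))
    (hlim _ (Iio _) (by simp) (Ioo_mem_nhdsLT (by linarith)))
  rw [intervalIntegral.integral_of_le (by linarith), integral_Ioc_eq_integral_Ioo, sub_zero,
    integral_const_mul, one_mul, integral_add, integral_sub, integral_const_mul,
    integral_const_mul, integral_const_mul] at hI
  · exact hI
  · exact i1.const_mul _
  · exact i2.const_mul _
  · exact (i1.const_mul _).sub (i2.const_mul _)
  · exact i3.const_mul _

/-! ### The imaginary axis -/

theorem neg_log_cosh_nonpos (y : ℝ) : -Real.log (Real.cosh y) ≤ 0 :=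
  neg_nonpos.2 (Real.log_nonneg (Real.one_le_cosh y))

theorem continuous_log_cosh : Continuous fun y : ℝ => Real.log (Real.cosh y) :=
  Real.continuous_cosh.log fun y => (Real.cosh_pos y).ne'

theorem cosPow_I_mul (s : ℂ) (y : ℝ) :
    cosPow s (Complex.I * (y : ℂ)) = Complex.exp (s * (Real.log (Real.cosh y) : ℂ)) := by
  rw [cosPow, logCos_eq_log_cos _ (by simp [Real.pi_pos]), mul_comm Complex.I, Complex.cos_mul_I,
    ← Complex.ofReal_cosh, Complex.ofReal_log (Real.cosh_pos y).le]

theorem integrable_exp_neg_log_cosh {σ : ℝ} (hσ : 0 < σ) :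
    Integrable (fun y : ℝ => Real.exp (σ * -Real.log (Real.cosh y))) := by
  have hm : Continuous fun y : ℝ => Real.exp (σ * -Real.log (Real.cosh y)) :=
    Real.continuous_exp.comp (continuous_const.mul continuous_log_cosh.neg)
  have hb : ∀ y : ℝ, y - Real.log 2 ≤ Real.log (Real.cosh y) := by
    intro y
    rw [← Real.log_exp y, ← Real.log_div (Real.exp_pos _).ne' two_ne_zero, Real.log_exp]
    refine Real.log_le_log (by positivity) ?_
    rw [Real.cosh_eq]
    linarith [Real.exp_pos (-y)]
  have hb' : ∀ y : ℝ, -y - Real.log 2 ≤ Real.log (Real.cosh y) := fun y => by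
    simpa using hb (-y)
  rw [← integrableOn_univ, ← Set.Iic_union_Ioi (a := (0 : ℝ))]
  refine IntegrableOn.union ?_ ?_
  · refine ((integrableOn_exp_mul_Iic hσ 0).const_mul (Real.exp (σ * Real.log 2))).mono'
      hm.aestronglyMeasurable (Eventually.of_forall fun y => ?_)
    rw [Real.norm_of_nonneg (Real.exp_pos _).le, ← Real.exp_add]
    refine Real.exp_le_exp.2 ?_
    nlinarith [hb' y]
  · refine ((integrableOn_exp_mul_Ioi (neg_neg_of_pos hσ) 0).const_mul
      (Real.exp (σ * Real.log 2))).mono' hm.aestronglyMeasurable (Eventually.of_forall fun y => ?_)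
    rw [Real.norm_of_nonneg (Real.exp_pos _).le, ← Real.exp_add]
    refine Real.exp_le_exp.2 ?_
    nlinarith [hb y]

theorem continuous_exp_log_cosh (s : ℝ) :
    Continuous fun y : ℝ => Real.exp (s * Real.log (Real.cosh y)) :=
  Real.continuous_exp.comp (continuous_const.mul continuous_log_cosh)

/-- The integral of `(cosh t) ^ (α - 1)` from `0` to `y`. -/
def coshPrimitive (α y : ℝ) : ℝ :=
  ∫ t in (0 : ℝ)..y, Real.exp ((α - 1) * Real.log (Real.cosh t))

theorem hasDerivAt_coshPrimitive (α y : ℝ) :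
    HasDerivAt (coshPrimitive α) (Real.exp ((α - 1) * Real.log (Real.cosh y))) y :=
  intervalIntegral.integral_hasDerivAt_right
    ((continuous_exp_log_cosh _).intervalIntegrable _ _)
    (continuous_exp_log_cosh _).stronglyMeasurable.stronglyMeasurableAtFilter
    (continuous_exp_log_cosh _).continuousAt

theorem hasDerivAt_log_cosh (y : ℝ) :
    HasDerivAt (fun y => Real.log (Real.cosh y)) (Real.sinh y / Real.cosh y) y :=
  (Real.hasDerivAt_cosh y).log (Real.cosh_pos y).ne'

theorem abs_sinh_le_cosh (y : ℝ) : |Real.sinh y| ≤ Real.cosh y := by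
  rw [abs_le]
  constructor
  · have := Real.sinh_lt_cosh (x := -y)
    rw [Real.sinh_neg, Real.cosh_neg] at this
    linarith
  · exact (Real.sinh_lt_cosh (x := y)).le

/-- Compare with C sinh y (cosh y)^(α-1), C = 1 + 1/α, which also vanishes at 0. With c = cosh y,
monotonicity of the sum and of the difference amounts to C(α(c²-1)+1) ± c ≥ 0, which holds because C
≥ 1 and Cα ≥ 1. -/
theorem abs_coshPrimitive_le (hα : 0 < α) (y : ℝ) :
    |coshPrimitive α y| ≤ (1 + 1 / α) * Real.exp (α * Real.log (Real.cosh y)) := by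
  have hexp : ∀ y : ℝ, Real.exp ((α - 1) * Real.log (Real.cosh y)) * Real.cosh y
      = Real.exp (α * Real.log (Real.cosh y)) := by
    intro y
    nth_rewrite 2 [← Real.exp_log (Real.cosh_pos y)]
    rw [← Real.exp_add]
    congr 1
    ring
  have hmono : ∀ e : ℝ, (e = 1 ∨ e = -1) → Monotone fun y => (1 + 1 / α) * (Real.sinh y
      * Real.exp ((α - 1) * Real.log (Real.cosh y))) + e * coshPrimitive α y := by
    intro e he
    have hd : ∀ y : ℝ, HasDerivAt (fun y => (1 + 1 / α) * (Real.sinh y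
      * Real.exp ((α - 1) * Real.log (Real.cosh y))) + e * coshPrimitive α y) _ y := fun y =>
      (((Real.hasDerivAt_sinh y).mul (((hasDerivAt_log_cosh y).const_mul (α - 1)).exp)).const_mul
        (1 + 1 / α)).add ((hasDerivAt_coshPrimitive α y).const_mul e)
    refine monotone_of_hasDerivAt_nonneg hd fun y => ?_
    have hc := Real.one_le_cosh y
    have hs : Real.sinh y ^ 2 = Real.cosh y ^ 2 - 1 := by linarith [Real.cosh_sq y]
    have hE := Real.exp_pos ((α - 1) * Real.log (Real.cosh y))
    set c := Real.cosh y
    set E := Real.exp ((α - 1) * Real.log c)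
    have hc0 : 0 < c := by linarith
    have h1 : (1 + 1 / α) * (c * E + Real.sinh y * (E * ((α - 1) * (Real.sinh y / c)))) + e * E
        = E / c * ((1 + α) * (c ^ 2 - 1) + (1 + 1 / α) + e * c) := by
      have : Real.sinh y * (E * ((α - 1) * (Real.sinh y / c)))
          = E * (α - 1) * (c ^ 2 - 1) / c := by rw [← hs]; ring
      rw [this]
      field_simp
      ring
    change 0 ≤ (1 + 1 / α) * (c * E + Real.sinh y * (E * ((α - 1) * (Real.sinh y / c)))) + e * E
    rw [h1]
    have h2 : 0 < 1 / α := by positivity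
    have h3 : 0 ≤ α * (c ^ 2 - 1) := mul_nonneg hα.le (by nlinarith)
    refine mul_nonneg (by positivity) ?_
    rcases he with rfl | rfl <;> nlinarith
  have h0 : coshPrimitive α 0 = 0 := intervalIntegral.integral_same
  have hE := Real.exp_pos ((α - 1) * Real.log (Real.cosh y))
  have hk : 0 < 1 + 1 / α := by positivity
  have hbound : |coshPrimitive α y| ≤ (1 + 1 / α) * (|Real.sinh y|
      * Real.exp ((α - 1) * Real.log (Real.cosh y))) := by
    have a1 := hmono 1 (Or.inl rfl)
    have a2 := hmono (-1) (Or.inr rfl)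
    rcases le_total 0 y with h | h
    · have b1 := a1 h
      have b2 := a2 h
      simp only [Real.sinh_zero, h0] at b1 b2
      rw [abs_of_nonneg (Real.sinh_nonneg_iff.2 h), abs_le]
      constructor <;> linarith
    · have b1 := a1 h
      have b2 := a2 h
      simp only [Real.sinh_zero, h0] at b1 b2
      rw [abs_of_nonpos (Real.sinh_nonpos_iff.2 h), abs_le]
      constructor <;> linarith
  refine hbound.trans (mul_le_mul_of_nonneg_left ?_ hk.le)
  rw [← hexp, mul_comm]
  exact mul_le_mul_of_nonneg_left (abs_sinh_le_cosh y) hE.le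

/-- The function `Ftilde α` on the imaginary axis, as a function of the imaginary part. -/
def imagF (α y : ℝ) : ℂ := (realF α 0 : ℂ) + Complex.I * (coshPrimitive α y : ℂ)

theorem Ftilde_I_mul (hα : 0 < α) (y : ℝ) : Ftilde α (Complex.I * (y : ℂ)) = imagF α y := by
  have h0 : (0 : ℝ) ∈ Ioo (-(Real.pi / 2)) (Real.pi / 2) := by
    constructor <;> linarith [Real.pi_pos]
  have h1 := Ftilde_ofReal hα h0
  simp only [Ftilde, Complex.ofReal_im, Complex.ofReal_re, intervalIntegral.integral_same,
    mul_zero, add_zero] at h1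
  have h2 : ∫ t in (0 : ℝ)..y, cosPow ((α : ℂ) - 1) (Complex.I * (t : ℂ))
      = (coshPrimitive α y : ℂ) := by
    rw [coshPrimitive, ← intervalIntegral.integral_ofReal]
    refine intervalIntegral.integral_congr fun t _ => ?_
    simp only [cosPow_I_mul]
    push_cast
    rfl
  simp only [Ftilde, Complex.mul_re, Complex.mul_im, Complex.I_re, Complex.I_im,
    Complex.ofReal_re, Complex.ofReal_im, zero_mul, one_mul, mul_zero, sub_zero, zero_add, add_zero,
    intervalIntegral.integral_same]
  rw [h1, h2, imagF]

theorem hasDerivAt_imagF (α y : ℝ) :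
    HasDerivAt (imagF α)
      (Complex.I * Complex.exp (((α : ℂ) - 1) * (Real.log (Real.cosh y) : ℂ))) y := by
  have := ((hasDerivAt_coshPrimitive α y).ofReal_comp.const_mul Complex.I).const_add
    (realF α 0 : ℂ)
  refine HasDerivAt.congr_deriv this ?_
  push_cast
  rfl

theorem continuous_imagF (α : ℝ) : Continuous (imagF α) :=
  continuous_iff_continuousAt.2 fun y => (hasDerivAt_imagF α y).continuousAt

theorem exists_bound_imagF (hα : 0 < α) :
    ∃ M : ℝ, 0 ≤ M ∧ ∀ y : ℝ, ‖imagF α y‖ ≤ M * Real.exp (α * Real.log (Real.cosh y)) := by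
  refine ⟨|realF α 0| + (1 + 1 / α), by positivity, fun y => ?_⟩
  have h1 : 1 ≤ Real.exp (α * Real.log (Real.cosh y)) :=
    Real.one_le_exp (mul_nonneg hα.le (Real.log_nonneg (Real.one_le_cosh y)))
  calc ‖imagF α y‖ ≤ |realF α 0| + |coshPrimitive α y| := by
        refine (norm_add_le _ _).trans ?_
        rw [norm_mul, Complex.norm_I, one_mul, Complex.norm_real, Complex.norm_real]
        rfl
    _ ≤ |realF α 0| * Real.exp (α * Real.log (Real.cosh y))
        + (1 + 1 / α) * Real.exp (α * Real.log (Real.cosh y)) :=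
        add_le_add (le_mul_of_one_le_right (abs_nonneg _) h1) (abs_coshPrimitive_le hα y)
    _ = _ := by ring

/-- The function `imagF α`, divided by `(cosh y) ^ α`. -/
def imagFNormalized (α y : ℝ) : ℂ :=
  Complex.exp (-(α * (Real.log (Real.cosh y) : ℂ))) * imagF α y

theorem continuous_imagFNormalized (α : ℝ) : Continuous (imagFNormalized α) :=
  (Complex.continuous_exp.comp
    (continuous_const.mul (Complex.continuous_ofReal.comp continuous_log_cosh)).neg).mul
    (continuous_imagF α)

theorem integrable_exp_log_cosh_mul_norm (hα : 0 < α) (n : ℕ) (σ : ℝ) (hσ : 0 < σ) :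
    Integrable (fun y : ℝ => Real.exp (σ * -Real.log (Real.cosh y)) * ‖imagFNormalized α y ^ n‖) := by
  obtain ⟨M, hM0, hM⟩ := exists_bound_imagF hα
  refine (integrable_exp_neg_log_cosh hσ).mul_bdd (c := M ^ n)
    ((continuous_imagFNormalized α).pow n).norm.aestronglyMeasurable
    (Eventually.of_forall fun y => ?_)
  rw [norm_norm, norm_pow]
  refine pow_le_pow_left₀ (norm_nonneg _) ?_ n
  have hE := Real.exp_pos (α * Real.log (Real.cosh y))
  rw [imagFNormalized, norm_mul, Complex.norm_exp]
  have : (-((α : ℂ) * (Real.log (Real.cosh y) : ℂ))).re = -(α * Real.log (Real.cosh y)) := by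
    simp
  rw [this, Real.exp_neg, inv_mul_le_iff₀ hE, mul_comm]
  exact hM y

/-- The moments `∫ (cosh y) ^ s (F (i y)) ^ n dy` over the imaginary axis. -/
def imagMoment (α : ℝ) (n : ℕ) (s : ℂ) : ℂ :=
  ∫ y : ℝ, Complex.exp (s * (Real.log (Real.cosh y) : ℂ)) * imagF α y ^ n

/-- Moves the growth of F^n into the exponent. What remains is a bounded factor against an
exponential of -log cosh ≤ 0, the shape required by the lemmas on parameter integrals. -/
theorem exp_mul_imagF_pow (α : ℝ) (n : ℕ) (s : ℂ) (y : ℝ) :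
    Complex.exp (s * (Real.log (Real.cosh y) : ℂ)) * imagF α y ^ n
      = Complex.exp (-(s + α * n) * ((-Real.log (Real.cosh y) : ℝ) : ℂ))
        * imagFNormalized α y ^ n := by
  rw [imagFNormalized, mul_pow, ← mul_assoc, ← Complex.exp_nat_mul, ← Complex.exp_add]
  congr 2
  push_cast
  ring

theorem integrable_imagMoment (hα : 0 < α) (n : ℕ) {s : ℂ} (hs : s.re + α * n < 0) :
    Integrable (fun y : ℝ => Complex.exp (s * (Real.log (Real.cosh y) : ℂ)) * imagF α y ^ n) := by
  simp only [exp_mul_imagF_pow]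
  refine integrable_exp_mul (σ₀ := 0) continuous_log_cosh.neg.measurable
    ((continuous_imagFNormalized α).pow n).aestronglyMeasurable
    (integrable_exp_log_cosh_mul_norm hα n) ?_
  simp
  linarith

theorem differentiableOn_imagMoment (hα : 0 < α) (n : ℕ) :
    DifferentiableOn ℂ (imagMoment α n) {s | s.re + α * n < 0} := by
  have h := differentiableOn_integral_exp_mul (μ := volume) (σ₀ := 0)
    continuous_log_cosh.neg.measurable neg_log_cosh_nonpos
    ((continuous_imagFNormalized α).pow n).aestronglyMeasurable
    (integrable_exp_log_cosh_mul_norm hα n)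
  have h2 : DifferentiableOn ℂ (fun s : ℂ => -(s + α * n)) {s | s.re + α * n < 0} := by fun_prop
  have h3 := h.comp h2 (fun s hs => by
    have hs : s.re + α * n < 0 := hs
    simp
    linarith)
  refine h3.congr fun s _ => ?_
  simp only [imagMoment, exp_mul_imagF_pow]
  rfl

theorem integrandA_eq (hα : 0 < α) (N : ℕ) (κ : ℂ) :
    integrandA α N κ = fun y : ℝ =>
      Complex.exp ((-(α : ℂ) * (κ + N) - 1) * (Real.log (Real.cosh y) : ℂ)) * imagF α y ^ N := by
  funext y
  rw [integrandA, cosPow_I_mul, Ftilde_I_mul hα]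

theorem integrable_integrandA (hα : 0 < α) (N : ℕ) {κ : ℂ} (hκ : -(1 / α) < κ.re) :
    Integrable (integrandA α N κ) := by
  rw [integrandA_eq hα]
  refine integrable_imagMoment hα N ?_
  rw [neg_lt, lt_div_iff₀ hα] at hκ
  simp
  linarith

/-- No limits at infinity are needed: the antiderivative and its derivative are both integrable on
the line, so the derivative has integral zero. -/
theorem imagMoment_relation (hα : 0 < α) (n : ℕ) {p : ℂ} (hp : p.re + 1 + α * n < 0) :
    (1 + p) * imagMoment α n (p + 1) - p * imagMoment α n (p - 1)
      + n * (n - 1) / (p + α) * imagMoment α (n - 2) (p + 2 * α - 1) = 0 := by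
  have hne : n = 0 ∨ p + α ≠ 0 := by
    refine n.eq_zero_or_pos.imp_right fun hn h => ?_
    have h1 : (1 : ℝ) ≤ n := by exact_mod_cast hn
    have h2 := congrArg Complex.re h
    simp at h2
    nlinarith
  set W : ℝ → ℂ := fun t => Complex.exp (p * (Real.log (Real.cosh t) : ℂ))
      * (Complex.I * (Real.sinh t : ℂ)) * imagF α t ^ n
    + n / (p + α) * (Complex.exp ((p + α) * (Real.log (Real.cosh t) : ℂ))
      * imagF α t ^ (n - 1)) with hW
  have hderiv : ∀ x : ℝ, HasDerivAt W _ x := fun x => by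
    have hc := Real.cosh_pos x
    have hexp : Complex.exp (Real.log (Real.cosh x) : ℂ) = (Real.cosh x : ℂ) := by
      rw [← Complex.ofReal_exp, Real.exp_log hc]
    refine hasDerivAt_primitive (ε := Complex.I) n hne
      (ℓ := fun t => (Real.log (Real.cosh t) : ℂ))
      (S := fun t => Complex.I * (Real.sinh t : ℂ)) (F := imagF α) (p := p) ?_ ?_ ?_ ?_
    · refine HasDerivAt.congr_deriv (hasDerivAt_log_cosh x).ofReal_comp ?_
      rw [Complex.exp_neg, hexp, ← mul_assoc, neg_mul, Complex.I_mul_I]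
      push_cast
      ring
    · rw [hexp]
      exact (Real.hasDerivAt_sinh x).ofReal_comp.const_mul Complex.I
    · exact hasDerivAt_imagF α x
    · rw [hexp, mul_pow, Complex.I_sq]
      have := Real.cosh_sq x
      have h2 : (Real.cosh x : ℂ) ^ 2 = (Real.sinh x : ℂ) ^ 2 + 1 := by exact_mod_cast this
      rw [h2]
      ring
  have hα1 : p.re + α * n < -1 := by linarith
  have i1 := integrable_imagMoment hα n (s := p + 1) (by simp; linarith)
  have i2 := integrable_imagMoment hα n (s := p - 1) (by simp; linarith)
  -- For n < 2 the moment itself need not converge, so integrability rests on the vanishing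
  -- coefficient.
  have i3 : Integrable (fun y : ℝ => n * (n - 1) / (p + α) *
      (Complex.exp ((p + 2 * α - 1) * (Real.log (Real.cosh y) : ℂ)) * imagF α y ^ (n - 2))) := by
    rcases n with _ | _ | n
    · simp
    · simp
    · refine (integrable_imagMoment hα n ?_).const_mul _
      push_cast at hα1
      simp
      linarith
  have i4 := (((i1.const_mul (1 + p)).sub (i2.const_mul p)).add i3).const_mul Complex.I
  have iW : Integrable W := by
    refine Integrable.add ?_ ?_
    · refine i1.mono ?_ (Eventually.of_forall fun y => ?_)
      · refine Continuous.aestronglyMeasurable ?_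
        exact ((Complex.continuous_exp.comp (continuous_const.mul
          (Complex.continuous_ofReal.comp continuous_log_cosh))).mul (continuous_const.mul
          (Complex.continuous_ofReal.comp Real.continuous_sinh))).mul ((continuous_imagF α).pow n)
      · have hexp : Complex.exp (Real.log (Real.cosh y) : ℂ) = (Real.cosh y : ℂ) := by
          rw [← Complex.ofReal_exp, Real.exp_log (Real.cosh_pos y)]
        rw [add_mul, one_mul, Complex.exp_add, hexp]
        simp only [norm_mul, Complex.norm_I, one_mul, Complex.norm_real]
        refine mul_le_mul_of_nonneg_right (mul_le_mul_of_nonneg_left ?_ (norm_nonneg _))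
          (norm_nonneg _)
        rw [Real.norm_eq_abs, Real.norm_of_nonneg (Real.cosh_pos y).le]
        exact abs_sinh_le_cosh y
    · rcases n with _ | n
      · simp
      · refine (integrable_imagMoment hα n ?_).const_mul _
        push_cast at hα1
        simp
        linarith
  have hI := integral_eq_zero_of_hasDerivAt_of_integrable hderiv i4 iW
  rw [integral_const_mul, mul_eq_zero, or_iff_right Complex.I_ne_zero, integral_add, integral_sub,
    integral_const_mul, integral_const_mul, integral_const_mul] at hI
  · exact hI
  · exact i1.const_mul _
  · exact i2.const_mul _
  · exact (i1.const_mul _).sub (i2.const_mul _)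
  · exact i3

/-! ### Normalized moments and their meromorphic continuation -/

/-- The moments over the real interval, normalized so that `B{P + i, P} = normB α i P / Γ(P)`. -/
def normB (α : ℝ) (i : ℕ) (P : ℂ) : ℂ :=
  (α : ℂ) ^ i / (i.factorial : ℂ) * realMoment α i ((α : ℂ) * P - 1)

/-- The moments over the imaginary axis, normalized so that
`A[P, P - j] = Γ(P + 1) * normA α j P`. -/
def normA (α : ℝ) (j : ℕ) (P : ℂ) : ℂ :=
  (α : ℂ) ^ (j + 1) / (j.factorial : ℂ) / (2 * (Real.pi : ℂ))
    * imagMoment α j (-((α : ℂ) * P) - 1)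

theorem differentiableOn_normB (hα : 0 < α) (i : ℕ) :
    DifferentiableOn ℂ (normB α i) {P | 0 < P.re} := by
  have h : DifferentiableOn ℂ (fun P : ℂ => (α : ℂ) * P - 1) {P | 0 < P.re} := by fun_prop
  refine ((differentiableOn_realMoment hα i).comp h fun P hP => ?_).const_mul _
  have hP : 0 < P.re := hP
  simp
  positivity

theorem differentiableOn_normA (hα : 0 < α) (j : ℕ) :
    DifferentiableOn ℂ (normA α j) {P | j - 1 / α < P.re} := by
  have h : DifferentiableOn ℂ (fun P : ℂ => -((α : ℂ) * P) - 1) {P | j - 1 / α < P.re} := by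
    fun_prop
  refine ((differentiableOn_imagMoment hα j).comp h fun P hP => ?_).const_mul _
  have hP : j - 1 / α < P.re := hP
  have h1 : α * (j - 1 / α) < α * P.re := mul_lt_mul_of_pos_left hP hα
  have h2 : α * (j - 1 / α) = α * j - 1 := by field_simp
  simp
  linarith

theorem normB_relation_of_lt_two (hα : 0 < α) {i : ℕ} (hi : i < 2) {P : ℂ} (hP : 0 < P.re) :
    P * normB α i P - (P + 1 / α) * normB α i (P + 2 / α) = 0 := by
  have hα' : (α : ℂ) ≠ 0 := by exact_mod_cast hα.ne'
  have h := realMoment_relation hα i (p := α * P) (by simp; positivity)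
  have hz : (i : ℂ) * (i - 1) = 0 := by interval_cases i <;> simp
  rw [hz] at h
  have e : (α : ℂ) * (P + 2 / α) - 1 = α * P + 1 := by field_simp; ring
  have e' : P + 1 / α = (1 + α * P) / α := by field_simp; ring
  rw [normB, normB, e, e']
  rw [zero_div, zero_mul, add_zero] at h
  have h2 : P - α * P / α = 0 := by field_simp; ring
  linear_combination (-((α : ℂ) ^ i / (i.factorial : ℂ) / α)) * h
    + ((α : ℂ) ^ i / (i.factorial : ℂ)) * realMoment α i (α * P - 1) * h2

/-- The moment relation at p = αP; the factor α^i/i! in `normB` absorbs the coefficient n(n-1). -/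
theorem normB_relation (hα : 0 < α) (i : ℕ) {P : ℂ} (hP : 0 < P.re) :
    P * normB α (i + 2) P - (P + 1 / α) * normB α (i + 2) (P + 2 / α)
      = normB α i (P + 2) / (P + 1) := by
  have hα' : (α : ℂ) ≠ 0 := by exact_mod_cast hα.ne'
  have hP1 : P + 1 ≠ 0 := fun h => by
    have := congrArg Complex.re h
    simp at this
    linarith
  have h := realMoment_relation hα (i + 2) (p := α * P) (by simp; positivity)
  rw [Nat.add_sub_cancel] at h
  have e1 : (α : ℂ) * (P + 2 / α) - 1 = α * P + 1 := by field_simp; ring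
  have e2 : (α : ℂ) * (P + 2) - 1 = α * P + 2 * α - 1 := by ring
  have e3 : (α : ℂ) * P + α = α * (P + 1) := by ring
  have hf : ((i + 2).factorial : ℂ) = (i + 2) * (i + 1) * i.factorial := by
    rw [Nat.factorial_succ, Nat.factorial_succ]
    push_cast
    ring
  have hi : (i.factorial : ℂ) ≠ 0 := by exact_mod_cast i.factorial_ne_zero
  have hi1 : (i : ℂ) + 1 ≠ 0 := by exact_mod_cast i.succ_ne_zero
  have hi2 : (i : ℂ) + 2 ≠ 0 := by exact_mod_cast (i + 1).succ_ne_zero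
  rw [normB, normB, normB, e1, e2, hf]
  rw [e3] at h
  push_cast at h
  generalize realMoment α (i + 2) (α * P - 1) = x at h ⊢
  generalize realMoment α (i + 2) (α * P + 1) = y at h ⊢
  generalize realMoment α i (α * P + 2 * α - 1) = z at h ⊢
  field_simp at h ⊢
  linear_combination (-(α : ℂ) ^ (i + 1)) * h

theorem normA_relation_of_lt_two (hα : 0 < α) {j : ℕ} (hj : j < 2) {P : ℂ}
    (hP : j + 1 / α < P.re) :
    P * normA α j P - (P - 1 / α) * normA α j (P - 2 / α) = 0 := by
  have hα' : (α : ℂ) ≠ 0 := by exact_mod_cast hα.ne'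
  have hre : (-((α : ℂ) * P)).re + 1 + α * j < 0 := by
    have h1 : α * (j + 1 / α) < α * P.re := mul_lt_mul_of_pos_left hP hα
    have h2 : α * (j + 1 / α) = α * j + 1 := by field_simp
    simp
    linarith
  have h := imagMoment_relation hα j hre
  have hz : (j : ℂ) * (j - 1) = 0 := by interval_cases j <;> simp
  rw [hz, zero_div, zero_mul, add_zero] at h
  have e1 : -((α : ℂ) * (P - 2 / α)) - 1 = -(α * P) + 1 := by field_simp; ring
  rw [normA, normA, e1]
  generalize imagMoment α j (-(α * P) - 1) = x at h ⊢
  generalize imagMoment α j (-(α * P) + 1) = y at h ⊢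
  have h2 : P - α * P / α = 0 := by field_simp; ring
  linear_combination ((α : ℂ) ^ (j + 1) / (j.factorial : ℂ) / (2 * (Real.pi : ℂ))) *
    (h / α + x * h2 - y * h2)

/-- The moment relation at p = -αP. The threshold on Re P is the one needed for convergence at the
leftmost argument P - 2/α. -/
theorem normA_relation (hα : 0 < α) (j : ℕ) {P : ℂ} (hP : (j + 2 : ℕ) + 1 / α < P.re) :
    P * normA α (j + 2) P - (P - 1 / α) * normA α (j + 2) (P - 2 / α)
      = normA α j (P - 2) / (P - 1) := by
  have hα' : (α : ℂ) ≠ 0 := by exact_mod_cast hα.ne'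
  have hP1 : P - 1 ≠ 0 := fun h => by
    have h1 := congrArg Complex.re h
    have h2 : 0 < 1 / α := by positivity
    have h3 : (0 : ℝ) ≤ j := Nat.cast_nonneg j
    push_cast at hP
    rw [Complex.sub_re, Complex.one_re, Complex.zero_re] at h1
    linarith
  have hre : (-((α : ℂ) * P)).re + 1 + α * (j + 2 : ℕ) < 0 := by
    have h1 : α * ((j + 2 : ℕ) + 1 / α) < α * P.re := mul_lt_mul_of_pos_left hP hα
    have h2 : α * ((j + 2 : ℕ) + 1 / α) = α * (j + 2 : ℕ) + 1 := by field_simp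
    rw [Complex.neg_re, Complex.re_ofReal_mul]
    linarith
  have h := imagMoment_relation hα (j + 2) hre
  rw [Nat.add_sub_cancel] at h
  have e1 : -((α : ℂ) * (P - 2 / α)) - 1 = -(α * P) + 1 := by field_simp; ring
  have e2 : -((α : ℂ) * (P - 2)) - 1 = -(α * P) + 2 * α - 1 := by ring
  have e3 : -((α : ℂ) * P) + α = -(α * (P - 1)) := by ring
  have hf : ((j + 2).factorial : ℂ) = (j + 2) * (j + 1) * j.factorial := by
    rw [Nat.factorial_succ, Nat.factorial_succ]
    push_cast
    ring
  have hj : (j.factorial : ℂ) ≠ 0 := by exact_mod_cast j.factorial_ne_zero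
  have hj1 : (j : ℂ) + 1 ≠ 0 := by exact_mod_cast j.succ_ne_zero
  have hj2 : (j : ℂ) + 2 ≠ 0 := by exact_mod_cast (j + 1).succ_ne_zero
  have hpi : (Real.pi : ℂ) ≠ 0 := by exact_mod_cast Real.pi_ne_zero
  rw [normA, normA, normA, e1, e2, hf]
  rw [e3, div_neg] at h
  push_cast at h
  generalize imagMoment α (j + 2) (-(α * P) - 1) = x at h ⊢
  generalize imagMoment α (j + 2) (-(α * P) + 1) = y at h ⊢
  generalize imagMoment α j (-(α * P) + 2 * α - 1) = z at h ⊢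
  field_simp at h ⊢
  linear_combination (α : ℂ) ^ (j + 2) * h

theorem exists_meromorphic_normB (hα : 0 < α) (i : ℕ) :
    ∃ g : ℂ → ℂ, Meromorphic g ∧ EqOn g (normB α i) {P | 0 < P.re} := by
  have hδ : 0 < 2 / α := by positivity
  have hcast : ((2 / α : ℝ) : ℂ) = 2 / α := by push_cast; rfl
  have hne : ∀ z : ℂ, 0 < z.re → z ≠ 0 := fun z hz h => by simp [h] at hz
  have hr : Meromorphic (fun z : ℂ => (z + 1 / α) / z) :=
    (meromorphic_id.add (Meromorphic.const (1 / (α : ℂ)))).div meromorphic_id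
  induction i using Nat.strong_induction_on with
  | _ i ih =>
    by_cases hi : i < 2
    · refine exists_meromorphic_of_shift hδ (differentiableOn_normB hα i) hr
        (Meromorphic.const (0 : ℂ)) fun z hz => ?_
      have h := normB_relation_of_lt_two hα hi hz
      have := hne z hz
      rw [hcast]
      field_simp
      linear_combination h
    · obtain ⟨i, rfl⟩ : ∃ k, i = k + 2 := ⟨i - 2, by omega⟩
      obtain ⟨g, hg, hgeq⟩ := ih i (by omega)
      refine exists_meromorphic_of_shift (h := fun z => g (z + 2) / (z + 1) / z) hδ
        (differentiableOn_normB hα (i + 2)) hr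
        (((Meromorphic.add_const hg 2).div (meromorphic_id.add (Meromorphic.const (1 : ℂ)))).div
          meromorphic_id) fun z hz => ?_
      have h := normB_relation hα i hz
      have h0 := hne z hz
      have h2 : g (z + 2) = normB α i (z + 2) := hgeq (by
        have hz : 0 < z.re := hz
        simp
        linarith)
      rw [hcast, h2, ← h]
      field_simp
      ring

/-- The relation at P = z + 2/α is solved for the value at z. Its inhomogeneous term has index lower
by 2 and must be meromorphic on all of ℂ, so its continuation is supplied by strong induction. -/
theorem exists_meromorphic_normA (hα : 0 < α) (j : ℕ) :
    ∃ g : ℂ → ℂ, Meromorphic g ∧ EqOn g (normA α j) {P | j - 1 / α < P.re} := by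
  have hδ : 0 < 2 / α := by positivity
  have hcast : ((2 / α : ℝ) : ℂ) = 2 / α := by push_cast; rfl
  have hre1 : ((1 : ℂ) / α).re = 1 / α := by
    rw [← Complex.ofReal_one, ← Complex.ofReal_div, Complex.ofReal_re]
  have hre2 : ((2 : ℂ) / α).re = 2 / α := by rw [← hcast, Complex.ofReal_re]
  have h2D : 2 / α = 1 / α + 1 / α := by ring
  have hne : ∀ (z : ℂ) (j : ℕ), j - 1 / α < z.re → z + 1 / α ≠ 0 := fun z j hz h => by
    have h1 := congrArg Complex.re h
    rw [Complex.add_re, hre1, Complex.zero_re] at h1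
    have : (0 : ℝ) ≤ j := Nat.cast_nonneg j
    linarith
  have hr : Meromorphic (fun z : ℂ => (z + 2 / α) / (z + 1 / α)) :=
    (meromorphic_id.add (Meromorphic.const (2 / (α : ℂ)))).div
      (meromorphic_id.add (Meromorphic.const (1 / (α : ℂ))))
  induction j using Nat.strong_induction_on with
  | _ j ih =>
    by_cases hj : j < 2
    · refine exists_meromorphic_of_shift hδ (differentiableOn_normA hα j) hr
        (Meromorphic.const (0 : ℂ)) fun z hz => ?_
      have h := normA_relation_of_lt_two hα hj (P := z + 2 / α)
        (by rw [Complex.add_re, hre2]; linarith)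
      have := hne z j hz
      rw [hcast, add_zero, div_mul_eq_mul_div, eq_div_iff this]
      rw [add_sub_cancel_right] at h
      linear_combination -h
    · obtain ⟨j, rfl⟩ : ∃ k, j = k + 2 := ⟨j - 2, by omega⟩
      obtain ⟨g, hg, hgeq⟩ := ih j (by omega)
      refine exists_meromorphic_of_shift
        (h := fun z => -(g (z + (2 / α - 2)) / (z + (2 / α - 1)) / (z + 1 / α))) hδ
        (differentiableOn_normA hα (j + 2)) hr
        ((((Meromorphic.add_const hg (2 / α - 2)).div
          (meromorphic_id.add (Meromorphic.const (2 / (α : ℂ) - 1)))).div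
          (meromorphic_id.add (Meromorphic.const (1 / (α : ℂ)))))).neg fun z hz => ?_
      have h := normA_relation hα j (P := z + 2 / α)
        (by rw [Complex.add_re, hre2]; linarith)
      have h0 := hne z _ hz
      have h2 : g (z + (2 / α - 2)) = normA α j (z + (2 / α - 2)) := hgeq (by
        push_cast at hz
        have : 0 < 1 / α := by positivity
        rw [mem_ofPred_eq, Complex.add_re, Complex.sub_re, hre2, Complex.re_ofNat]
        linarith)
      rw [hcast, h2]
      rw [add_sub_cancel_right, add_sub_assoc z (2 / (α : ℂ)) 2, add_sub_assoc z (2 / (α : ℂ)) 1] at h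
      rw [← h]
      field_simp
      ring

/-- The meromorphic continuation of `normB α i`. -/
def contB (hα : 0 < α) (i : ℕ) : ℂ → ℂ := Classical.choose (exists_meromorphic_normB hα i)

/-- The meromorphic continuation of `normA α j`. -/
def contA (hα : 0 < α) (j : ℕ) : ℂ → ℂ := Classical.choose (exists_meromorphic_normA hα j)

theorem meromorphic_contB (hα : 0 < α) (i : ℕ) : Meromorphic (contB hα i) :=
  (Classical.choose_spec (exists_meromorphic_normB hα i)).1

theorem contB_eq (hα : 0 < α) (i : ℕ) {P : ℂ} (hP : 0 < P.re) : contB hα i P = normB α i P :=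
  (Classical.choose_spec (exists_meromorphic_normB hα i)).2 hP

theorem meromorphic_contA (hα : 0 < α) (j : ℕ) : Meromorphic (contA hα j) :=
  (Classical.choose_spec (exists_meromorphic_normA hα j)).1

theorem contA_eq (hα : 0 < α) (j : ℕ) {P : ℂ} (hP : j - 1 / α < P.re) :
    contA hα j P = normA α j P :=
  (Classical.choose_spec (exists_meromorphic_normA hα j)).2 hP

theorem re_two_div_ofReal (α : ℝ) : ((2 : ℂ) / α).re = 2 / α := by
  rw [← Complex.ofReal_ofNat, ← Complex.ofReal_div, Complex.ofReal_re]

theorem meromorphic_contB_relation (hα : 0 < α) (i : ℕ) :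
    Meromorphic (fun P => P * contB hα i P - (P + 1 / α) * contB hα i (P + 2 / α)) :=
  (meromorphic_id.mul (meromorphic_contB hα i)).sub
    ((meromorphic_id.add (Meromorphic.const (1 / (α : ℂ)))).mul
      (Meromorphic.add_const (meromorphic_contB hα i) (2 / α)))

theorem meromorphic_contA_relation (hα : 0 < α) (j : ℕ) :
    Meromorphic (fun P => P * contA hα j P - (P - 1 / α) * contA hα j (P - 2 / α)) := by
  simp only [sub_eq_add_neg _ (2 / (α : ℂ))]
  exact (meromorphic_id.mul (meromorphic_contA hα j)).sub
    ((meromorphic_id.sub (Meromorphic.const (1 / (α : ℂ)))).mul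
      (Meromorphic.add_const (meromorphic_contA hα j) (-(2 / α))))

theorem contB_relation_of_lt_two (hα : 0 < α) {i : ℕ} (hi : i < 2) :
    ∀ᶠ P in codiscrete ℂ, P * contB hα i P - (P + 1 / α) * contB hα i (P + 2 / α) = 0 := by
  refine eventually_codiscrete_eq_of_eqOn (meromorphic_contB_relation hα i)
    (Meromorphic.const (0 : ℂ)) (isOpen_re_gt 0) ⟨1, by simp⟩ fun P hP => ?_
  have hP : 0 < P.re := hP
  have h2 : 0 < 2 / α := by positivity
  rw [contB_eq hα i hP, contB_eq hα i (by rw [Complex.add_re, re_two_div_ofReal]; linarith)]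
  exact normB_relation_of_lt_two hα hi hP

theorem contB_relation (hα : 0 < α) (i : ℕ) :
    ∀ᶠ P in codiscrete ℂ, P * contB hα (i + 2) P - (P + 1 / α) * contB hα (i + 2) (P + 2 / α)
      = contB hα i (P + 2) / (P + 1) := by
  refine eventually_codiscrete_eq_of_eqOn (meromorphic_contB_relation hα (i + 2))
    ((Meromorphic.add_const (meromorphic_contB hα i) 2).div
      (meromorphic_id.add (Meromorphic.const (1 : ℂ)))) (isOpen_re_gt 0) ⟨1, by simp⟩ fun P hP => ?_
  have hP : 0 < P.re := hP
  have h2 : 0 < 2 / α := by positivity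
  rw [contB_eq hα _ hP, contB_eq hα _ (by rw [Complex.add_re, re_two_div_ofReal]; linarith),
    contB_eq hα _ (by rw [Complex.add_re, Complex.re_ofNat]; linarith)]
  exact normB_relation hα i hP

theorem contA_relation_of_lt_two (hα : 0 < α) {j : ℕ} (hj : j < 2) :
    ∀ᶠ P in codiscrete ℂ, P * contA hα j P - (P - 1 / α) * contA hα j (P - 2 / α) = 0 := by
  refine eventually_codiscrete_eq_of_eqOn (meromorphic_contA_relation hα j)
    (Meromorphic.const (0 : ℂ)) (isOpen_re_gt (j + 1 / α))
    ⟨((j + 1 / α + 1 : ℝ) : ℂ), by rw [mem_ofPred_eq, Complex.ofReal_re]; linarith⟩ fun P hP => ?_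
  have hP : j + 1 / α < P.re := hP
  have h2 : 0 < 1 / α := by positivity
  have h3 : 2 / α = 1 / α + 1 / α := by ring
  rw [contA_eq hα j (by linarith),
    contA_eq hα j (by rw [Complex.sub_re, re_two_div_ofReal]; linarith)]
  exact normA_relation_of_lt_two hα hj hP

theorem contA_relation (hα : 0 < α) (j : ℕ) :
    ∀ᶠ P in codiscrete ℂ, P * contA hα (j + 2) P - (P - 1 / α) * contA hα (j + 2) (P - 2 / α)
      = contA hα j (P - 2) / (P - 1) := by
  have hm : Meromorphic (fun P => contA hα j (P - 2) / (P - 1)) := by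
    simp only [sub_eq_add_neg]
    exact (Meromorphic.add_const (meromorphic_contA hα j) (-2)).div
      (meromorphic_id.add (Meromorphic.const (-1 : ℂ)))
  refine eventually_codiscrete_eq_of_eqOn (meromorphic_contA_relation hα (j + 2)) hm
    (isOpen_re_gt ((j + 2 : ℕ) + 1 / α))
    ⟨(((j + 2 : ℕ) + 1 / α + 1 : ℝ) : ℂ), by rw [mem_ofPred_eq, Complex.ofReal_re]; linarith⟩
    fun P hP => ?_
  have hP : (j + 2 : ℕ) + 1 / α < P.re := hP
  have h2 : 0 < 1 / α := by positivity
  have h3 : 2 / α = 1 / α + 1 / α := by ring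
  have h4 : ((j + 2 : ℕ) : ℝ) = j + 2 := by push_cast; ring
  rw [contA_eq hα _ (by linarith),
    contA_eq hα _ (by rw [Complex.sub_re, re_two_div_ofReal]; linarith),
    contA_eq hα _ (by rw [Complex.sub_re, Complex.re_ofNat]; linarith)]
  exact normA_relation hα j hP

/-! ### The quantities `B` and `A` -/

theorem integralB_eq (hα : 0 < α) (N : ℕ) (κ : ℂ) :
    integralB α N κ = (Complex.Gamma κ)⁻¹ * normB α N κ := by
  rw [integralB, integral_integrandB hα, normB, ← mul_assoc]
  congr 1
  rw [div_mul_eq_div_div, div_right_comm, div_eq_inv_mul]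

theorem integralA_eq (hα : 0 < α) (N : ℕ) (κ : ℂ) :
    integralA α N κ = Complex.Gamma (κ + N + 1) * normA α N (κ + N) := by
  have hI := Complex.I_ne_zero
  have hpi : (Real.pi : ℂ) ≠ 0 := by exact_mod_cast Real.pi_ne_zero
  have hf : (N.factorial : ℂ) ≠ 0 := by exact_mod_cast N.factorial_ne_zero
  rw [integralA, integrandA_eq hα, normA, imagMoment]
  simp only [neg_mul]
  field_simp

theorem isMeromorphicExtension_tildeB (hα : 0 < α) (N : ℕ) :
    IsMeromorphicExtension domainB (integralB α N) (fun κ => tildeB α (κ + N) κ) := by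
  have hfun : (fun κ => tildeB α (κ + N) κ) = meromorphicExtension domainB (integralB α N) :=
    funext fun κ => tildeB_add_natCast α N κ
  rw [hfun]
  have heq : EqOn (fun κ => (Complex.Gamma κ)⁻¹ * contB hα N κ) (integralB α N) domainB :=
    fun κ hκ => by simp only [integralB_eq hα, contB_eq hα N hκ]
  refine isMeromorphicExtension_meromorphicExtension (IsMeromorphicExtension.toMeromorphicNFOn
    (Meromorphic.Gamma.inv.mul (meromorphic_contB hα N)) (fun κ hκ => ?_) heq)
  have hd : DifferentiableOn ℂ (fun κ => (Complex.Gamma κ)⁻¹ * contB hα N κ) {κ | 0 < κ.re} := by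
    refine Complex.differentiable_one_div_Gamma.differentiableOn.mul ?_
    exact (differentiableOn_normB hα N).congr fun κ hκ => contB_eq hα N hκ
  exact hd.analyticAt ((isOpen_re_gt 0).mem_nhds hκ)

theorem analyticAt_Gamma {s : ℂ} (hs : ∀ m : ℕ, s ≠ -m) : AnalyticAt ℂ Complex.Gamma s := by
  have h : AnalyticAt ℂ (fun s => (Complex.Gamma s)⁻¹) s :=
    Complex.differentiable_one_div_Gamma.analyticAt s
  have h2 := h.inv (inv_ne_zero (Complex.Gamma_ne_zero hs))
  refine h2.congr (Eventually.of_forall fun z => ?_)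
  simp

theorem isMeromorphicExtension_tildeA (hα : 0 < α) (N : ℕ) :
    IsMeromorphicExtension (domainA α N) (integralA α N) (fun κ => tildeA α (κ + N) κ) := by
  have hfun : (fun κ => tildeA α (κ + N) κ)
      = meromorphicExtension (domainA α N) (integralA α N) :=
    funext fun κ => tildeA_add_natCast α N κ
  rw [hfun]
  have hre : ∀ κ : ℂ, -(1 / α) < κ.re → N - 1 / α < (κ + N).re := fun κ hκ => by
    rw [Complex.add_re, Complex.natCast_re]
    linarith
  have heq : EqOn (fun κ => Complex.Gamma (κ + (N + 1)) * contA hα N (κ + N)) (integralA α N)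
      (domainA α N) :=
    fun κ hκ => by simp only [integralA_eq hα, contA_eq hα N (hre κ hκ.1), add_assoc]
  refine isMeromorphicExtension_meromorphicExtension (IsMeromorphicExtension.toMeromorphicNFOn
    ((Meromorphic.add_const Meromorphic.Gamma (N + 1 : ℂ)).mul
      (Meromorphic.add_const (meromorphic_contA hα N) N)) (fun κ hκ => ?_) heq)
  have hd : DifferentiableOn ℂ (fun κ : ℂ => contA hα N (κ + N)) {κ | -(1 / α) < κ.re} := by
    have h1 : DifferentiableOn ℂ (fun κ : ℂ => κ + N) {κ | -(1 / α) < κ.re} := by fun_prop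
    exact ((differentiableOn_normA hα N).comp h1 hre).congr fun κ hκ => contA_eq hα N (hre κ hκ)
  refine AnalyticAt.mul ?_ (hd.analyticAt ((isOpen_re_gt _).mem_nhds hκ.1))
  refine (analyticAt_Gamma fun m => ?_).fun_comp (analyticAt_id.add analyticAt_const)
  have := hκ.2 m
  rwa [add_assoc] at this

theorem meromorphic_tildeB (hα : 0 < α) (N : ℕ) : Meromorphic (fun κ => tildeB α (κ + N) κ) :=
  meromorphicOn_univ.1 (isMeromorphicExtension_tildeB hα N).1.meromorphicOn

theorem meromorphic_tildeA (hα : 0 < α) (N : ℕ) : Meromorphic (fun κ => tildeA α (κ + N) κ) :=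
  meromorphicOn_univ.1 (isMeromorphicExtension_tildeA hα N).1.meromorphicOn

theorem eventually_tildeB_eq (hα : 0 < α) (N : ℕ) :
    ∀ᶠ z in codiscrete ℂ, tildeB α (z + N) z = (Complex.Gamma z)⁻¹ * contB hα N z := by
  refine eventually_codiscrete_eq_of_eqOn (meromorphic_tildeB hα N)
    (Meromorphic.Gamma.inv.mul (meromorphic_contB hα N)) (isOpen_re_gt 0) ⟨1, by simp⟩ fun z hz => ?_
  have h := (isMeromorphicExtension_tildeB hα N).2 hz
  simp only at h
  simp only [h, integralB_eq hα]
  rw [contB_eq hα N hz]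

theorem eventually_tildeA_eq (hα : 0 < α) (N : ℕ) :
    ∀ᶠ z in codiscrete ℂ, tildeA α z (z - N) = Complex.Gamma (z + 1) * contA hα N z := by
  have h : ∀ᶠ z in codiscrete ℂ, tildeA α (z + N) z
      = Complex.Gamma (z + (N + 1)) * contA hα N (z + N) := by
    refine eventually_codiscrete_eq_of_eqOn (meromorphic_tildeA hα N)
      ((Meromorphic.add_const Meromorphic.Gamma (N + 1 : ℂ)).mul
        (Meromorphic.add_const (meromorphic_contA hα N) N)) (isOpen_re_gt 0) ⟨1, by simp⟩
      fun z hz => ?_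
    have hz : 0 < z.re := hz
    have hpos : 0 < 1 / α := by positivity
    have hdom : z ∈ domainA α N := by
      refine ⟨by linarith, fun j h => ?_⟩
      have h1 := congrArg Complex.re h
      simp at h1
      have h2 : (0 : ℝ) ≤ j := Nat.cast_nonneg j
      have h3 : (0 : ℝ) ≤ N := Nat.cast_nonneg N
      linarith
    have h := (isMeromorphicExtension_tildeA hα N).2 hdom
    simp only at h
    simp only [h, integralA_eq hα]
    rw [contA_eq hα N (by rw [Complex.add_re, Complex.natCast_re]; linarith), add_assoc]
  filter_upwards [eventually_codiscrete_add h (-N)] with z hz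
  rw [show z + -(N : ℂ) + N = z by ring, show z + -(N : ℂ) + (N + 1) = z + 1 by ring,
    ← sub_eq_add_neg] at hz
  exact hz

/-- The common form of the summands of both identities. -/
def mixedTerm (hα : 0 < α) (P Q : ℂ) (i j : ℕ) : ℂ :=
  (P + Q) / 2 * (contB hα i P * contA hα j Q)

/-- The A-relation at P and the B-relation at P-2 share the inhomogeneous product b_i(P)
a_j(P-2)/(P-1); eliminating it leaves only values of `mixedTerm`. -/
theorem mixedTerm_relation (hα : 0 < α) (i j : ℕ) : ∀ᶠ P in codiscrete ℂ,
    mixedTerm hα P (P - 2 * (1 / α)) i (j + 2) = mixedTerm hα P P i (j + 2)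
      - mixedTerm hα (P - 2) (P - 2) (i + 2) j
      + mixedTerm hα (P - 2 + 2 * (1 / α)) (P - 2) (i + 2) j := by
  filter_upwards [contA_relation hα j, eventually_codiscrete_add (contB_relation hα i) (-2)]
    with P h1 h2
  rw [← sub_eq_add_neg, show P - 2 + 2 = P by ring, show P - 2 + 1 = P - 1 by ring] at h2
  rw [show (2 : ℂ) / α = 2 * (1 / α) by ring] at h1 h2
  simp only [mixedTerm]
  linear_combination (-contB hα i P) * h1 + contA hα j (P - 2) * h2

theorem mixedTerm_left_relation (hα : 0 < α) {j : ℕ} (hj : j < 2) (i : ℕ) :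
    ∀ᶠ P in codiscrete ℂ, mixedTerm hα P (P - 2 * (1 / α)) i j = mixedTerm hα P P i j := by
  filter_upwards [contA_relation_of_lt_two hα hj] with P h1
  rw [show (2 : ℂ) / α = 2 * (1 / α) by ring] at h1
  simp only [mixedTerm]
  linear_combination (-contB hα i P) * h1

theorem mixedTerm_right_relation (hα : 0 < α) {i : ℕ} (hi : i < 2) (j : ℕ) :
    ∀ᶠ P in codiscrete ℂ, mixedTerm hα (P + 2 * (1 / α)) P i j = mixedTerm hα P P i j := by
  filter_upwards [contB_relation_of_lt_two hα hi] with P h1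
  rw [show (2 : ℂ) / α = 2 * (1 / α) by ring] at h1
  simp only [mixedTerm]
  linear_combination (-contA hα j P) * h1

/-- The Gamma quotient in the weight cancels the normalizations of B and A, and z - 1/α is the mean
of z and z - 2/α. -/
theorem eventually_shifted_product_eq (hα : 0 < α) (i j : ℕ) : ∀ᶠ z in codiscrete ℂ,
    tildeB α (z + i) z * ((z - 1 / α) * Complex.Gamma z / Complex.Gamma (z + 1 - 2 / α))
      * tildeA α (z - 2 / α) (z - 2 / α - j) = mixedTerm hα z (z - 2 * (1 / α)) i j := by
  filter_upwards [eventually_tildeB_eq hα i,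
    eventually_codiscrete_add (eventually_tildeA_eq hα j) (-(2 / α)),
    eventually_codiscrete_Gamma_ne_zero,
    eventually_codiscrete_add eventually_codiscrete_Gamma_ne_zero (1 - 2 / α)] with z h1 h2 h3 h4
  rw [← sub_eq_add_neg, show z - 2 / (α : ℂ) + 1 = z + 1 - 2 / α by ring] at h2
  rw [← add_sub_assoc] at h4
  rw [h1, h2, mixedTerm, show 2 * (1 / (α : ℂ)) = 2 / α by ring]
  generalize contB hα i z = x
  generalize contA hα j (z - 2 / α) = y
  generalize Complex.Gamma z = g at h3 ⊢
  generalize Complex.Gamma (z + 1 - 2 / α) = g' at h4 ⊢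
  have h5 : (z + (z - 2 / (α : ℂ))) / 2 = z - 1 / α := by ring
  rw [h5]
  generalize z - 1 / (α : ℂ) = w
  field_simp

theorem eventually_product_eq (hα : 0 < α) (i j : ℕ) : ∀ᶠ z in codiscrete ℂ,
    tildeB α (z + i) z * tildeA α z (z - j) = mixedTerm hα z z i j := by
  filter_upwards [eventually_tildeB_eq hα i, eventually_tildeA_eq hα j,
    eventually_codiscrete_Gamma_ne_zero, eventually_codiscrete_ne 0] with z h1 h2 h3 h4
  rw [h1, h2, mixedTerm, Complex.Gamma_add_one z h4]
  field_simp
  ring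

/-! ### Meromorphy of both sides and proof of the two identities -/

theorem meromorphic_tildeB_shift (hα : 0 < α) {u v : ℂ} (N : ℕ) (h : u - v = N) :
    Meromorphic (fun k => tildeB α (k + u) (k + v)) := by
  have := Meromorphic.add_const (meromorphic_tildeB hα N) v
  rw [← h] at this
  simpa only [add_assoc, add_sub_cancel] using this

theorem meromorphic_tildeA_shift (hα : 0 < α) {u v : ℂ} (N : ℕ) (h : u - v = N) :
    Meromorphic (fun k => tildeA α (k + u) (k + v)) := by
  have := Meromorphic.add_const (meromorphic_tildeA hα N) v
  rw [← h] at this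
  simpa only [add_assoc, add_sub_cancel] using this

theorem meromorphic_shifted_product (hα : 0 < α) {u v w : ℂ} (i j : ℕ) (hi : u - v = i)
    (hj : v - w = j) :
    Meromorphic (fun k => tildeB α (k + u) (k + v)
      * ((k + v - 1 / α) * Complex.Gamma (k + v) / Complex.Gamma (k + v + 1 - 2 / α))
      * tildeA α (k + v - 2 / α) (k + w - 2 / α)) := by
  simp only [sub_eq_add_neg, add_assoc]
  refine ((meromorphic_tildeB_shift hα i hi).mul ?_).mul
    (meromorphic_tildeA_shift hα j (by rw [← hj]; ring))
  exact ((meromorphic_id.add (Meromorphic.const (v + -(1 / α)))).mul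
    (Meromorphic.add_const Meromorphic.Gamma v)).div
    (Meromorphic.add_const Meromorphic.Gamma (v + (1 + -(2 / α))))

theorem meromorphic_product (hα : 0 < α) {u v w : ℂ} (i j : ℕ) (hi : u - v = i)
    (hj : v - w = j) :
    Meromorphic (fun k => tildeB α (k + u) (k + v) * tildeA α (k + v) (k + w)) :=
  (meromorphic_tildeB_shift hα i hi).mul (meromorphic_tildeA_shift hα j hj)

theorem eventually_sum_congr {ι : Type*} {s : Finset ι} {f g : ι → ℂ → ℂ}
    (h : ∀ t ∈ s, ∀ᶠ k in codiscrete ℂ, f t k = g t k) :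
    ∀ᶠ k in codiscrete ℂ, ∑ t ∈ s, f t k = ∑ t ∈ s, g t k := by
  filter_upwards [(eventually_all_finset s).2 h] with k hk
  exact Finset.sum_congr rfl hk

theorem meromorphicOn_sum {ι : Type*} {s : Finset ι} {f : ι → ℂ → ℂ}
    (h : ∀ t ∈ s, Meromorphic (f t)) : MeromorphicOn (fun k => ∑ t ∈ s, f t k) univ := by
  have := Meromorphic.sum h
  have e : (∑ t ∈ s, f t) = fun k => ∑ t ∈ s, f t k := by
    funext k
    simp
  rw [e] at this
  exact meromorphicOn_univ.2 this

theorem eqAsMeromorphic_downward (hα : 0 < α) (a b : ℕ) :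
    EqAsMeromorphic
      (fun k : ℂ => ∑ s ∈ (Finset.range (b + 1)).filter Even,
        tildeB α (k + b + a) (k + b - s)
          * ((k + b - s - 1 / α) * Complex.Gamma (k + b - s)
            / Complex.Gamma (k + b - s + 1 - 2 / α))
          * tildeA α (k + b - s - 2 / α) (k - 2 / α))
      (fun k : ℂ => ∑ q ∈ (Finset.range (b + 1)).filter Even,
        tildeB α (k + b + a + q / α) (k + b - q + q / α)
          * tildeA α (k + b - q + q / α) (k + q / α)) := by
  refine ⟨meromorphicOn_sum fun s hs => ?_, meromorphicOn_sum fun q hq => ?_, ?_⟩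
  · have hs : s ≤ b := by simp at hs; omega
    convert meromorphic_shifted_product hα (u := b + a) (v := b - s) (w := 0) (a + s) (b - s)
      (by push_cast; ring) (by rw [Nat.cast_sub hs]; ring) using 2 with k
    rw [add_zero, ← add_sub_assoc, add_assoc]
  · have hq : q ≤ b := by simp at hq; omega
    convert meromorphic_product hα (u := b + a + q / α) (v := b - q + q / α) (w := q / α)
      (a + q) (b - q) (by push_cast; ring) (by rw [Nat.cast_sub hq]; ring) using 2 with k
    rw [← add_assoc, ← add_assoc k (b : ℂ) a, ← add_assoc k ((b : ℂ) - q), ← add_sub_assoc]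
  -- The chain lowers the A-index from `b` by 2 at each step and stops at its parity `r < 2`, where
  -- the A-relation becomes homogeneous.
  · set r := b % 2 with hr
    set n := b / 2 with hn
    have hr2 : r < 2 := Nat.mod_lt _ two_pos
    have hb : b = r + 2 * n := (Nat.mod_add_div b 2).symm
    have hbc : ∀ t ∈ Finset.range (n + 1),
        ((r + 2 * (n - t) : ℕ) : ℂ) = b - (2 * t : ℕ) := fun t ht => by
      rw [← Nat.cast_sub (by simp at ht; omega)]
      congr 1
      simp at ht
      omega
    have key := eventually_codiscrete_add
      (sum_eq_sum_diagonal (mixedTerm_relation hα) (mixedTerm_left_relation hα hr2) n a) (b : ℂ)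
    have hsum : ∀ f : ℕ → ℂ, ∑ s ∈ (Finset.range (b + 1)).filter Even, f s
        = ∑ t ∈ Finset.range (n + 1), f (2 * t) := fun f => by
      rw [hb]; exact sum_filter_even_range hr2 n f
    simp only [hsum]
    have hL := eventually_sum_congr (s := Finset.range (n + 1)) fun t _ =>
      eventually_codiscrete_add (eventually_shifted_product_eq hα (a + 2 * t) (r + 2 * (n - t)))
        (b - (2 * t : ℕ))
    have hR := eventually_sum_congr (s := Finset.range (n + 1)) fun t _ =>
      eventually_codiscrete_add (eventually_product_eq hα (a + 2 * t) (r + 2 * (n - t)))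
        (b - (2 * t : ℕ) + (2 * t : ℕ) / α)
    filter_upwards [hL, hR, key] with k h1 h2 h3
    refine Eq.trans ?_ (h1.trans (Eq.trans ?_ (h3.trans (Eq.trans ?_ (h2.symm.trans ?_)))))
    · refine Finset.sum_congr rfl fun t ht => ?_
      rw [hbc t ht]
      push_cast
      ring_nf
    · refine Finset.sum_congr rfl fun t ht => ?_
      push_cast
      ring_nf
    · refine Finset.sum_congr rfl fun t ht => ?_
      push_cast
      ring_nf
    · refine Finset.sum_congr rfl fun t ht => ?_
      rw [hbc t ht]
      push_cast
      ring_nf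

theorem eqAsMeromorphic_upward (hα : 0 < α) (a b : ℕ) :
    EqAsMeromorphic
      (fun k : ℂ => ∑ s ∈ (Finset.Icc 2 a).filter Even,
        tildeB α (k + b + a) (k + b + s)
          * ((k + b + s - 1 / α) * Complex.Gamma (k + b + s)
            / Complex.Gamma (k + b + s + 1 - 2 / α))
          * tildeA α (k + b + s - 2 / α) (k - 2 / α))
      (fun k : ℂ => ∑ q ∈ (Finset.Icc 2 a).filter Even,
        tildeB α (k + b + a - q / α) (k + b + q - q / α)
          * tildeA α (k + b + q - q / α) (k - q / α)) := by
  refine ⟨meromorphicOn_sum fun s hs => ?_, meromorphicOn_sum fun q hq => ?_, ?_⟩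
  · have hs : s ≤ a := by simp at hs; omega
    convert meromorphic_shifted_product hα (u := b + a) (v := b + s) (w := 0) (a - s) (b + s)
      (by rw [Nat.cast_sub hs]; ring) (by push_cast; ring) using 2 with k
    rw [add_zero, ← add_assoc, ← add_assoc]
  · have hq : q ≤ a := by simp at hq; omega
    convert meromorphic_product hα (u := b + a - q / α) (v := b + q - q / α) (w := -(q / α))
      (a - q) (b + q) (by rw [Nat.cast_sub hq]; ring) (by push_cast; ring) using 2 with k
    rw [← sub_eq_add_neg, ← add_sub_assoc, ← add_sub_assoc, ← add_assoc, ← add_assoc]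
  -- Here the B-index is lowest at the far end of the chain, where it equals the parity `r < 2` of
  -- `a` and the B-relation is homogeneous.
  · set r := a % 2 with hr
    set n := a / 2 with hn
    have hr2 : r < 2 := Nat.mod_lt _ two_pos
    have ha : a = r + 2 * n := (Nat.mod_add_div a 2).symm
    have hac : ∀ t ∈ Finset.range n,
        ((r + 2 * (n - 1 - t) : ℕ) : ℂ) = a - (2 * (t + 1) : ℕ) := fun t ht => by
      rw [← Nat.cast_sub (by simp at ht; omega)]
      congr 1
      simp at ht
      omega
    have key := eventually_codiscrete_add
      (sum_up_eq_sum_diagonal (mixedTerm_relation hα) (mixedTerm_right_relation hα hr2) n b) (b : ℂ)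
    have hsum : ∀ f : ℕ → ℂ, ∑ s ∈ (Finset.Icc 2 a).filter Even, f s
        = ∑ t ∈ Finset.range n, f (2 * (t + 1)) := fun f => by
      rw [ha]; exact sum_filter_even_Icc hr2 n f
    simp only [hsum]
    have hL := eventually_sum_congr (s := Finset.range n) fun t _ =>
      eventually_codiscrete_add
        (eventually_shifted_product_eq hα (r + 2 * (n - 1 - t)) (b + 2 * (t + 1)))
        (b + (2 * (t + 1) : ℕ))
    have hR := eventually_sum_congr (s := Finset.range n) fun t _ =>
      eventually_codiscrete_add (eventually_product_eq hα (r + 2 * (n - 1 - t)) (b + 2 * (t + 1)))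
        (b + (2 * (t + 1) : ℕ) - (2 * (t + 1) : ℕ) / α)
    filter_upwards [hL, hR, key] with k h1 h2 h3
    refine Eq.trans ?_ (h1.trans (Eq.trans ?_ (h3.trans (Eq.trans ?_ (h2.symm.trans ?_)))))
    · refine Finset.sum_congr rfl fun t ht => ?_
      rw [hac t ht]
      push_cast
      ring_nf
    · refine Finset.sum_congr rfl fun t ht => ?_
      push_cast
      ring_nf
    · refine Finset.sum_congr rfl fun t ht => ?_
      push_cast
      ring_nf
    · refine Finset.sum_congr rfl fun t ht => ?_
      rw [hac t ht]
      push_cast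
      ring_nf

end BetaPrime

end

theorem theorem3p3 (α : ℝ) (hα : 0 < α) :
    -- the quantities are well defined: the integrals converge and have meromorphic extensions
    (∀ N : ℕ,
      (∀ κ ∈ BetaPrime.domainB, IntervalIntegrable (BetaPrime.integrandB α N κ)
        MeasureTheory.volume (-(Real.pi / 2)) (Real.pi / 2)) ∧
      BetaPrime.IsMeromorphicExtension BetaPrime.domainB (BetaPrime.integralB α N)
        (fun κ => BetaPrime.tildeB α (κ + N) κ)) ∧
    (∀ N : ℕ,
      (∀ κ : ℂ, -(1 / α) < κ.re → MeasureTheory.Integrable (BetaPrime.integrandA α N κ)) ∧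
      BetaPrime.IsMeromorphicExtension (BetaPrime.domainA α N) (BetaPrime.integralA α N)
        (fun κ => BetaPrime.tildeA α (κ + N) κ)) ∧
    -- the two identities, with `n - d = a` and `d - k = b` fixed
    (∀ a b : ℕ,
      BetaPrime.EqAsMeromorphic
        (fun k : ℂ =>
          let d : ℂ := k + b
          let n : ℂ := d + a
          ∑ s ∈ (Finset.range (b + 1)).filter Even,
            let m : ℂ := d - s
            BetaPrime.tildeB α n m
              * ((m - 1 / α) * Complex.Gamma m / Complex.Gamma (m + 1 - 2 / α))
              * BetaPrime.tildeA α (m - 2 / α) (k - 2 / α))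
        (fun k : ℂ =>
          let d : ℂ := k + b
          let n : ℂ := d + a
          ∑ q ∈ (Finset.range (b + 1)).filter Even,
            BetaPrime.tildeB α (n + q / α) (d - q + q / α)
              * BetaPrime.tildeA α (d - q + q / α) (k + q / α)) ∧
      BetaPrime.EqAsMeromorphic
        (fun k : ℂ =>
          let d : ℂ := k + b
          let n : ℂ := d + a
          ∑ s ∈ (Finset.Icc 2 a).filter Even,
            let m : ℂ := d + s
            BetaPrime.tildeB α n m
              * ((m - 1 / α) * Complex.Gamma m / Complex.Gamma (m + 1 - 2 / α))
              * BetaPrime.tildeA α (m - 2 / α) (k - 2 / α))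
        (fun k : ℂ =>
          let d : ℂ := k + b
          let n : ℂ := d + a
          ∑ q ∈ (Finset.Icc 2 a).filter Even,
            BetaPrime.tildeB α (n - q / α) (d + q - q / α)
              * BetaPrime.tildeA α (d + q - q / α) (k - q / α))) := by
  exact ⟨fun N => ⟨fun κ hκ => BetaPrime.intervalIntegrable_integrandB hα N hκ,
      BetaPrime.isMeromorphicExtension_tildeB hα N⟩,
    fun N => ⟨fun κ hκ => BetaPrime.integrable_integrandA hα N hκ,
      BetaPrime.isMeromorphicExtension_tildeA hα N⟩,
    fun a b => ⟨BetaPrime.eqAsMeromorphic_downward hα a b,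
      BetaPrime.eqAsMeromorphic_upward hα a b⟩⟩
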